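/- Let $(x_n)_{n\ge 0}$ and $(\phi_n)_{n\ge 0}$ be computable sequences of real numbers (that is, the $n$-th term can be computably approximated by rationals to within $2^{-k}$, uniformly in $n$ and $k$) such that $\sum_{n} x_n^2=\infty$. Let $\alpha\in\{-1,1\}^{\mathbb N}$ be Kolmogorov–Chaitin complex, i.e. there is $k$ such that $K(\alpha_0\cdots\alpha_{n-1})\ge n-k$ for all $n$, where $K$ is prefix-free Kolmogorov complexity, and let $\varepsilon_n(\alpha)=\alpha_n$. For $N\ge 1$ let $$\sigma_N(t)=\sum_{n=0}^{N}\Bigl(1-\frac nN\Bigr)\varepsilon_n(\alpha)\,x_n\cos(2\pi nt+\phi_n)$$ be the Fejér sums of the series $\sum_{n\ge 0}\varepsilon_n(\alpha)x_n\cos(2\pi nt+\phi_n)$. Then $$\limsup_{N\to\infty}\int_0^1|\sigma_N(t)|\,dt=\infty .$$ Moreover, this series is not a Fourier–Stieltjes series: there is no complex (in particular, no finite signed) Borel measure $\mu$ on $[0,1]$ such that $$\varepsilon_0(\alpha)x_0\cos\phi_0=\int d\mu\quad\text{and}\quad \varepsilon_n(\alpha)x_n e^{\pm i\phi_n}=2\int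 e^{\mp 2\pi i n t}\,d\mu(t)\quad (n\ge 1).$$ -/

import Mathlib

open MeasureTheory Filter Topology

namespace AlgRandom

/-! ### Prefix-free machines and Kolmogorov complexity -/

/-- A prefix-free machine: a partial recursive map from programs to finite binary strings
whose domain contains no two distinct programs one of which is an initial segment of the other. -/
structure IsPrefixFreeMachine (M : List Bool →. List Bool) : Prop where
  partrec : Partrec M
  prefixFree : ∀ p q : List Bool, (M p).Dom → (M q).Dom → p <+: q → p = q

/-- A prefix-free machine is optimal if it simulates every prefix-free machine at the cost of an
additive constant in the program length. -/
structure IsOptimalMachine (U : List Bool →. List Bool) : Prop where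
  isPrefixFreeMachine : IsPrefixFreeMachine U
  optimal : ∀ M : List Bool →. List Bool, IsPrefixFreeMachine M →
    ∃ c : ℕ, ∀ p a : List Bool, a ∈ M p → ∃ q : List Bool, a ∈ U q ∧ q.length ≤ p.length + c

/-- Two different strings, one of which is an initial segment of the other. -/
def Conflict (a b : List Bool) : Prop := a ≠ b ∧ (a <+: b ∨ b <+: a)

/-- `haltStep c s`, where `s` codes a pair `(p, k)`: the pair of `p` and the output of the program
with code `c` on input `p`, if that computation stops within `k` steps. -/
def haltStep (c : Nat.Partrec.Code) (s : ℕ) : Option (List Bool × List Bool) :=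
  (Encodable.decode (α := List Bool × ℕ) s).bind fun pk =>
    ((Nat.Partrec.Code.evaln pk.2 c (Encodable.encode pk.1)).bind
      (Encodable.decode (α := List Bool))).map fun a => (pk.1, a)

/-- No computation of `c` found before stage `s` has an input that conflicts with `p`. -/
def NoConflict (c : Nat.Partrec.Code) (s : ℕ) (p : List Bool) : Prop :=
  ∀ s' < s, ∀ r ∈ haltStep c s', ¬ Conflict r.1 p

open Classical in
/-- The computation found at stage `s`, kept only if its input conflicts with no earlier one. The
computations kept are the graph of a prefix-free restriction of the machine with code `c`. -/
noncomputable def accept (c : Nat.Partrec.Code) (s : ℕ) : Option (List Bool × List Bool) :=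
  (haltStep c s).bind fun r => if NoConflict c s r.1 then some r else none

open Classical in
/-- The universal prefix-free machine: on the program `1 ⋯ 1 0 p` with `e` ones it runs the
prefix-free restriction of the `e`-th machine on `p`. -/
noncomputable def universalMachine (q : List Bool) : Part (List Bool) :=
  Nat.rfindOpt fun m =>
    (accept (Denumerable.ofNat Nat.Partrec.Code m.unpair.1) m.unpair.2).bind fun r =>
      if q = List.replicate m.unpair.1 true ++ false :: r.1 then some r.2 else none

section Universal

open Nat.Partrec Primrec

theorem primrecRel_prefix : PrimrecRel fun a b : List Bool => a <+: b :=
  (Primrec.eq.comp (f := fun x : List Bool × List Bool => x.1)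
    (g := fun x : List Bool × List Bool => x.2.take x.1.length) Primrec.fst
    (Primrec.list_take.comp (Primrec.list_length.comp Primrec.fst) Primrec.snd)).of_eq
    fun x => by simpa using (List.prefix_iff_eq_take (l₁ := x.1) (l₂ := x.2)).symm

theorem primrecRel_conflict : PrimrecRel Conflict := by
  refine PrimrecPred.and (PrimrecPred.not Primrec.eq) (PrimrecPred.or primrecRel_prefix ?_)
  exact PrimrecRel.comp primrecRel_prefix Primrec.snd Primrec.fst

theorem primrec_haltStep : Primrec₂ haltStep := by
  unfold haltStep
  refine Primrec.option_bind (Primrec.decode.comp Primrec.snd) ?_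
  refine Primrec.option_map (f := fun x : (Code × ℕ) × (List Bool × ℕ) =>
    (Code.evaln x.2.2 x.1.1 (Encodable.encode x.2.1)).bind
      (Encodable.decode (α := List Bool))) ?_ ?_
  · refine Primrec.option_bind ?_ ?_
    · exact Code.primrec_evaln.comp (Primrec.pair (Primrec.pair (Primrec.snd.comp Primrec.snd)
        (Primrec.fst.comp Primrec.fst)) (Primrec.encode.comp (Primrec.fst.comp Primrec.snd)))
    · exact (Primrec.decode.comp Primrec.snd).to₂
  · exact (Primrec.pair (Primrec.fst.comp (Primrec.snd.comp Primrec.fst)) Primrec.snd).to₂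

theorem primrec_noConflict :
    PrimrecRel fun (s : ℕ) (y : Code × List Bool) => NoConflict y.1 s y.2 := by
  classical
  have h : PrimrecRel fun (s' : ℕ) (y : Code × List Bool) =>
      ∀ r ∈ haltStep y.1 s', ¬ Conflict r.1 y.2 := by
    refine PrimrecPred.of_eq (p := fun x : ℕ × (Code × List Bool) =>
      ∀ r ∈ (haltStep x.2.1 x.1).toList, ¬ Conflict r.1 x.2.2) ?_ fun x => by simp
    have hR : PrimrecRel fun (r : List Bool × List Bool) (x : ℕ × (Code × List Bool)) =>
        ¬ Conflict r.1 x.2.2 := by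
      refine PrimrecPred.not (PrimrecRel.comp primrecRel_conflict ?_ ?_)
      · exact Primrec.fst.comp Primrec.fst
      · exact Primrec.snd.comp (Primrec.snd.comp Primrec.snd)
    refine PrimrecRel.comp hR.forall_mem_list ?_ Primrec.id
    exact Primrec.optionToList.comp
      (primrec_haltStep.comp (Primrec.fst.comp Primrec.snd) Primrec.fst)
  exact (h.forall_mem_list.comp (Primrec.list_range.comp Primrec.fst) Primrec.snd).of_eq
    fun x => by simp [NoConflict]

theorem primrec_accept : Primrec₂ accept := by
  classical
  unfold accept
  have h : PrimrecPred fun x : (Code × ℕ) × (List Bool × List Bool) =>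
      NoConflict x.1.1 x.1.2 x.2.1 :=
    PrimrecRel.comp primrec_noConflict (Primrec.snd.comp Primrec.fst)
      (Primrec.pair (Primrec.fst.comp Primrec.fst) (Primrec.fst.comp Primrec.snd))
  have h2 := (Primrec.ite h (Primrec.option_some.comp Primrec.snd) (Primrec.const none)).to₂
  exact (Primrec.option_bind primrec_haltStep h2).of_eq fun x => by congr

theorem primrec_replicate : Primrec fun e : ℕ => List.replicate e true :=
  (Primrec.list_map Primrec.list_range (Primrec.const true).to₂).of_eq fun e => by simp

theorem partrec_universalMachine : Partrec universalMachine := by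
  classical
  unfold universalMachine
  refine Partrec.rfindOpt (Primrec₂.to_comp ?_)
  have hu : Primrec fun x : List Bool × ℕ => x.2.unpair := Primrec.unpair.comp Primrec.snd
  have h1 : Primrec fun x : List Bool × ℕ =>
      accept (Denumerable.ofNat Code x.2.unpair.1) x.2.unpair.2 :=
    primrec_accept.comp ((Primrec.ofNat Code).comp (Primrec.fst.comp hu)) (Primrec.snd.comp hu)
  have h : PrimrecPred fun x : (List Bool × ℕ) × (List Bool × List Bool) =>
      x.1.1 = List.replicate x.1.2.unpair.1 true ++ false :: x.2.1 := by
    refine Primrec.eq.comp (Primrec.fst.comp Primrec.fst) ?_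
    refine Primrec.list_append.comp
      (primrec_replicate.comp (Primrec.fst.comp (hu.comp Primrec.fst))) ?_
    exact Primrec.list_cons.comp (Primrec.const false) (Primrec.fst.comp Primrec.snd)
  have h2 := (Primrec.ite h (Primrec.option_some.comp (Primrec.snd.comp Primrec.snd))
      (Primrec.const none)).to₂
  exact (Primrec.option_bind h1 h2).of_eq fun x => by congr

theorem accept_sound {c : Code} {s : ℕ} {r : List Bool × List Bool} (h : r ∈ accept c s) :
    r ∈ haltStep c s ∧ NoConflict c s r.1 := by
  classical
  simp only [accept, Option.mem_def, Option.bind_eq_some_iff] at h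
  obtain ⟨r', h1, h2⟩ := h
  split_ifs at h2 with h3
  cases h2
  exact ⟨h1, h3⟩

theorem accept_not_conflict {c : Code} {s s' : ℕ} {r r' : List Bool × List Bool}
    (h : r ∈ accept c s) (h' : r' ∈ accept c s') : ¬ Conflict r.1 r'.1 := by
  obtain ⟨h1, h2⟩ := accept_sound h
  obtain ⟨h1', h2'⟩ := accept_sound h'
  rcases lt_trichotomy s s' with hs | rfl | hs
  · exact h2' s hs r h1
  · rw [Option.mem_unique h1 h1']
    exact fun hc => hc.1 rfl
  · intro hc
    exact h2 s' hs r' h1' ⟨hc.1.symm, hc.2.symm⟩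

theorem mem_universalMachine {q a : List Bool} (h : a ∈ universalMachine q) :
    ∃ e s p, (p, a) ∈ accept (Denumerable.ofNat Code e) s ∧
      q = List.replicate e true ++ false :: p := by
  classical
  obtain ⟨m, hm⟩ := Nat.rfindOpt_spec h
  simp only [Option.mem_def, Option.bind_eq_some_iff] at hm
  obtain ⟨r, h1, h2⟩ := hm
  split_ifs at h2 with h3
  cases h2
  exact ⟨_, _, _, h1, h3⟩

theorem replicate_prefix {e e' : ℕ} {p p' : List Bool}
    (h : List.replicate e true ++ false :: p <+: List.replicate e' true ++ false :: p') :
    e = e' ∧ p <+: p' := by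
  induction e generalizing e' with
  | zero =>
    cases e' with
    | zero => simpa using h
    | succ e' => simp [List.replicate_succ] at h
  | succ e ih =>
    cases e' with
    | zero => simp [List.replicate_succ] at h
    | succ e' =>
      simp only [List.replicate_succ, List.cons_append, List.cons_prefix_cons, true_and] at h
      obtain ⟨h1, h2⟩ := ih h
      exact ⟨by rw [h1], h2⟩

theorem haltStep_sound {c : Code} {s : ℕ} {r : List Bool × List Bool} (h : r ∈ haltStep c s) :
    Encodable.decode (α := List Bool) <$> Code.eval c (Encodable.encode r.1) =
      Part.some (some r.2) := by
  simp only [haltStep, Option.mem_def, Option.bind_eq_some_iff, Option.map_eq_some_iff] at h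
  obtain ⟨pk, _, a, ⟨n, h1, h2⟩, rfl⟩ := h
  have := Part.eq_some_iff.2 (Code.evaln_sound h1)
  simp [this, h2]

theorem isOptimalMachine_universalMachine : IsOptimalMachine universalMachine := by
  classical
  refine ⟨⟨partrec_universalMachine, ?_⟩, ?_⟩
  · intro q q' hq hq' hqq'
    obtain ⟨e, s, p, h1, h2⟩ := mem_universalMachine (Part.get_mem hq)
    obtain ⟨e', s', p', h1', h2'⟩ := mem_universalMachine (Part.get_mem hq')
    rw [h2, h2'] at hqq'
    obtain ⟨rfl, hp⟩ := replicate_prefix hqq'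
    by_contra hne
    refine accept_not_conflict h1 h1' ⟨fun hpp => hne ?_, Or.inl hp⟩
    simp only at hpp
    rw [h2, h2', hpp]
  · intro M hM
    obtain ⟨c, hc⟩ := Code.exists_code.1 hM.partrec
    have hc' : ∀ p : List Bool, Code.eval c (Encodable.encode p) =
        (M p).map Encodable.encode := by
      intro p
      rw [hc]
      simp
    have hstep : ∀ {s r}, r ∈ haltStep c s → r.2 ∈ M r.1 := by
      intro s r hr
      have h := haltStep_sound hr
      rw [hc'] at h
      have h' := Part.eq_some_iff.1 h
      simp only [Part.map_eq_map, Part.mem_map_iff] at h'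
      obtain ⟨n, ⟨a, ha, rfl⟩, hn⟩ := h'
      rw [Encodable.encodek] at hn
      cases hn
      exact ha
    refine ⟨Encodable.encode c + 1, fun p a ha => ?_⟩
    have hev : Encodable.encode a ∈ Code.eval c (Encodable.encode p) := by
      rw [hc']
      exact Part.mem_map _ ha
    obtain ⟨k, hk⟩ := Code.evaln_complete.1 hev
    have hhalt : (p, a) ∈ haltStep c (Encodable.encode (p, k)) := by
      simp only [haltStep, Option.mem_def, Encodable.encodek, Option.bind_some]
      rw [Option.mem_def.1 hk]
      simp
    have hacc : (p, a) ∈ accept c (Encodable.encode (p, k)) := by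
      simp only [accept, Option.mem_def, Option.bind_eq_some_iff]
      refine ⟨(p, a), hhalt, if_pos ?_⟩
      intro s' _ r hr hcon
      have hd := Part.dom_iff_mem.2 ⟨_, hstep hr⟩
      have hd' := Part.dom_iff_mem.2 ⟨_, ha⟩
      rcases hcon.2 with h | h
      · exact hcon.1 (hM.prefixFree _ _ hd hd' h)
      · exact hcon.1 (hM.prefixFree _ _ hd' hd h).symm
    set q := List.replicate (Encodable.encode c) true ++ false :: p with hq
    have hdom : (universalMachine q).Dom := by
      refine Nat.rfindOpt_dom.2
        ⟨Nat.pair (Encodable.encode c) (Encodable.encode (p, k)), a, ?_⟩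
      simp only [Nat.unpair_pair, Denumerable.ofNat_encode]
      rw [Option.mem_def.1 hacc]
      simp [hq]
    refine ⟨q, ?_, ?_⟩
    · have hb := Part.get_mem hdom
      obtain ⟨e, s, p', h1, h2⟩ := mem_universalMachine hb
      have hpre : List.replicate (Encodable.encode c) true ++ false :: p <+:
          List.replicate e true ++ false :: p' := by
        rw [← h2]
      obtain ⟨he, _⟩ := replicate_prefix hpre
      rw [← he, Denumerable.ofNat_encode] at h1
      rw [hq, ← he] at h2
      have hp : p = p' := by simpa using h2
      subst hp
      have := Part.mem_unique (hstep (accept_sound h1).1) ha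
      simp only at this
      rwa [this] at hb
    · simp [hq]
      omega

end Universal

/-- The (prefix-free) Kolmogorov complexity of a finite binary string: the length of a shortest
program for it on the universal prefix-free machine. -/
noncomputable def kolmogorovComplexity (a : List Bool) : ℕ∞ :=
  ⨅ (p : List Bool) (_ : a ∈ universalMachine p), (p.length : ℕ∞)

/-- The initial segment of length `n` of a binary sequence. -/
def initialSegment (α : ℕ → Bool) (n : ℕ) : List Bool := (List.range n).map α

/-- The Kolmogorov–Chaitin complex sequences, `∃ k, ∀ n, K (α↾n) ≥ n - k`. -/
def KC : Set (ℕ → Bool) :=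
  {α | ∃ k : ℕ, ∀ n : ℕ, (n : ℕ∞) ≤ kolmogorovComplexity (initialSegment α n) + k}

/-- The Rademacher sequence given by the bits of `α`; the bits `1` and `-1` are represented by
`true` and `false`. -/
def rademacher (α : ℕ → Bool) (n : ℕ) : ℝ := if α n then 1 else -1

/-! ### Computable sequences of real numbers -/

/-- A sequence of reals is computable if rationals `(-1)^s * a / b`, with `s, a, b` computable
functions of `n` and `k`, approximate its `n`-th term up to `2 ^ (-k)`. -/
def IsComputableSeq (x : ℕ → ℝ) : Prop :=
  ∃ s a b : ℕ → ℕ → ℕ, Computable₂ s ∧ Computable₂ a ∧ Computable₂ b ∧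
    (∀ n k, b n k ≠ 0) ∧
    ∀ n k, |x n - (-1) ^ s n k * (a n k : ℝ) / (b n k : ℝ)| ≤ 1 / 2 ^ k

/-! ### Trigonometric series -/

/-- The Fejér sum `∑_{n=0}^N (1 - n/N) x_n cos (2πnt + φ_n)`, `N ≥ 1`. -/
noncomputable def fejerSum (x φ : ℕ → ℝ) (N : ℕ) (t : ℝ) : ℝ :=
  ∑ n ∈ Finset.range (N + 1), (1 - (n : ℝ) / N) * (x n * Real.cos (2 * Real.pi * n * t + φ n))

/-- The integral of a complex function against a complex measure. -/
noncomputable def complexIntegral {X : Type*} [MeasurableSpace X] (μ : ComplexMeasure X)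
    (f : X → ℂ) : ℂ :=
  VectorMeasure.integral μ f (ContinuousLinearMap.mul ℝ ℂ)

/-- The series `∑ x_n cos (2πnt + φ_n)` is the Fourier–Stieltjes series of a complex Borel measure
on `[0,1]`. -/
def IsFourierStieltjes (x φ : ℕ → ℝ) : Prop :=
  ∃ μ : ComplexMeasure (Set.Icc (0 : ℝ) 1),
    ((x 0 * Real.cos (φ 0) : ℝ) : ℂ) = complexIntegral μ (fun _ => 1) ∧
    ∀ n : ℕ, 1 ≤ n →
      (x n : ℂ) * Complex.exp (Complex.I * φ n) =
        2 * complexIntegral μ (fun t => Complex.exp (-(2 * Real.pi * Complex.I * n * (t : ℝ)))) ∧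
      (x n : ℂ) * Complex.exp (-(Complex.I * φ n)) =
        2 * complexIntegral μ (fun t => Complex.exp (2 * Real.pi * Complex.I * n * (t : ℝ)))

end AlgRandom

/-!
The signs `α` are not complex as soon as they form a branch of a computable tree of binary strings
whose density tends to zero (`notMem_KC_of_tree`): to describe a long initial segment of `α` it
suffices to give its index in a level where the tree is sparse, and no rate at which the density
decreases is needed, since the level can be found by a search. So let the `L¹` norms of the Fejér
sums with signs `α` be bounded by `C`, and consider the tree of the strings along which no such norm
is large. It has to be computable, and its density has to tend to zero.

For the density, let the first `m` signs be fixed. The second and fourth moments of a Rademacher sum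
give the lower bound `s / 18` for the mean, over all choices of the following signs, of the `L¹`
norm of the rest of the Fejér sum, where `s` is the `ℓ²` norm of its amplitudes
(`le_sum_cube_integral`). By the argument of Paley and Zygmund a fixed proportion of the choices has
a norm above `s / 36` (`card_small_integral_le`). Since `∑ xₙ² = ∞`, at a suitable level `s` is so
large that the first `m` terms do not matter (`exists_card_fejerNorm_le`), and all these choices
are missing from the tree. Hence the density drops by a fixed factor infinitely often
(`exists_testTree_small`).

The tree is computable because the norms are, up to constants, values of a computable family of
reals (`exists_computableFamily_fejerNorm`): a Riemann sum of the modulus of the Fejér sum, in the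
variable in which the period is `2 π`, over the interval `[0, 8]`, which contains one period and is
contained in two, so that `π` itself need not be computed. The cosine is computed by halving its
argument until the quadratic Taylor polynomial is accurate, and doubling the angle back.

The Fejér sums of a Fourier–Stieltjes series are the convolutions of the measure with the Fejér
kernels, which are nonnegative with integral one, so their `L¹` norms are bounded by the total
variation (`IsFourierStieltjes.exists_integral_le`). The second claim thus follows from the first.
-/

namespace AlgRandom

/-! ### Binary strings -/

/-- The list of all binary strings of length `r`. -/
def strings : ℕ → List (List Bool)
  | 0 => [[]]
  | r + 1 => (strings r).map (List.cons true) ++ (strings r).map (List.cons false)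

theorem length_strings (r : ℕ) : (strings r).length = 2 ^ r := by
  induction r with
  | zero => rfl
  | succ r ih => simp [strings, ih]; ring

theorem mem_strings {r : ℕ} {l : List Bool} : l ∈ strings r ↔ l.length = r := by
  induction r generalizing l with
  | zero => simp [strings]
  | succ r ih =>
    cases l with
    | nil => simp [strings]
    | cons b l => cases b <;> simp [strings, ih]

theorem nodup_strings (r : ℕ) : (strings r).Nodup := by
  induction r with
  | zero => simp [strings]
  | succ r ih =>
    refine List.Nodup.append (ih.map List.cons_injective) (ih.map List.cons_injective) ?_
    intro l h1 h2
    simp only [List.mem_map] at h1 h2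
    obtain ⟨a, _, rfl⟩ := h1
    obtain ⟨b, _, hb⟩ := h2
    simp at hb

/-- The finite set of all binary strings of length `r`. -/
def cube (r : ℕ) : Finset (List Bool) := (strings r).toFinset

theorem mem_cube {r : ℕ} {l : List Bool} : l ∈ cube r ↔ l.length = r := by
  simp [cube, mem_strings]

theorem card_cube (r : ℕ) : (cube r).card = 2 ^ r := by
  rw [cube, List.toFinset_card_of_nodup (nodup_strings r), length_strings]

theorem sum_cube_zero (f : List Bool → ℝ) : ∑ l ∈ cube 0, f l = f [] := by
  simp [cube, strings]

theorem sum_cube_succ (r : ℕ) (f : List Bool → ℝ) :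
    ∑ l ∈ cube (r + 1), f l = ∑ l ∈ cube r, (f (true :: l) + f (false :: l)) := by
  rw [cube, cube, List.sum_toFinset _ (nodup_strings _), List.sum_toFinset _ (nodup_strings _),
    List.sum_map_add]
  simp [strings, Function.comp_def]

/-! ### Rademacher sums -/

/-- The sign coded by a bit. -/
def bitSign (b : Bool) : ℝ := if b then 1 else -1

/-- The signed sum `∑ ± bᵢ` with the signs given by the bits of the string `l`. -/
def radSum (b : ℕ → ℝ) (l : List Bool) : ℝ :=
  ∑ i ∈ Finset.range l.length, bitSign (l.getD i false) * b i

theorem radSum_cons (b : ℕ → ℝ) (e : Bool) (l : List Bool) :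
    radSum b (e :: l) = bitSign e * b 0 + radSum (fun i => b (i + 1)) l := by
  simp [radSum, Finset.sum_range_succ', add_comm]

theorem radSum_append (b : ℕ → ℝ) (l l' : List Bool) :
    radSum b (l ++ l') = radSum b l + radSum (fun i => b (l.length + i)) l' := by
  induction l generalizing b with
  | nil => simp [radSum]
  | cons e l ih =>
    rw [List.cons_append, radSum_cons, ih, radSum_cons, List.length_cons, add_assoc]
    simp only [add_right_comm]

theorem abs_bitSign (b : Bool) : |bitSign b| = 1 := by cases b <;> simp [bitSign]

theorem abs_radSum_le (b : ℕ → ℝ) (l : List Bool) :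
    |radSum b l| ≤ ∑ i ∈ Finset.range l.length, |b i| := by
  refine (Finset.abs_sum_le_sum_abs _ _).trans (le_of_eq ?_)
  simp [abs_mul, abs_bitSign]

/-- Second moment of a Rademacher sum. -/
theorem sum_cube_radSum_sq (r : ℕ) (b : ℕ → ℝ) :
    ∑ l ∈ cube r, radSum b l ^ 2 = 2 ^ r * ∑ i ∈ Finset.range r, b i ^ 2 := by
  induction r generalizing b with
  | zero => simp [sum_cube_zero, radSum]
  | succ r ih =>
    rw [sum_cube_succ, Finset.sum_range_succ']
    have h : ∀ l, radSum b (true :: l) ^ 2 + radSum b (false :: l) ^ 2 =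
        2 * b 0 ^ 2 + 2 * radSum (fun i => b (i + 1)) l ^ 2 := by
      intro l
      simp only [radSum_cons, bitSign]
      norm_num
      ring
    simp only [h, Finset.sum_add_distrib, ← Finset.mul_sum, ih, Finset.sum_const, card_cube,
      nsmul_eq_mul]
    push_cast
    ring

/-- Fourth moment of a Rademacher sum (Khinchine's inequality with the constant `3`). -/
theorem sum_cube_radSum_pow_four_le (r : ℕ) (b : ℕ → ℝ) :
    ∑ l ∈ cube r, radSum b l ^ 4 ≤ 2 ^ r * (3 * (∑ i ∈ Finset.range r, b i ^ 2) ^ 2) := by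
  induction r generalizing b with
  | zero => simp [sum_cube_zero, radSum]
  | succ r ih =>
    rw [sum_cube_succ, Finset.sum_range_succ']
    have h : ∀ l, radSum b (true :: l) ^ 4 + radSum b (false :: l) ^ 4 =
        2 * b 0 ^ 4 + 12 * b 0 ^ 2 * radSum (fun i => b (i + 1)) l ^ 2 +
          2 * radSum (fun i => b (i + 1)) l ^ 4 := by
      intro l
      simp only [radSum_cons, bitSign]
      norm_num
      ring
    simp only [h, Finset.sum_add_distrib, ← Finset.mul_sum, Finset.sum_const, card_cube,
      nsmul_eq_mul, sum_cube_radSum_sq]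
    have h4 := ih fun i => b (i + 1)
    have h0 : 0 ≤ (2 : ℝ) ^ r * b 0 ^ 4 := by positivity
    push_cast
    ring_nf at h4 h0 ⊢
    linarith

/-! ### Random trigonometric sums -/

/-- The term of index `m + i` of a trigonometric series with amplitudes `aᵢ` and phases `ψ`. -/
noncomputable def trigTerm (m : ℕ) (a ψ : ℕ → ℝ) (t : ℝ) (i : ℕ) : ℝ :=
  a i * Real.cos (2 * Real.pi * (m + i : ℕ) * t + ψ (m + i))

theorem continuous_radSum {b : ℝ → ℕ → ℝ} (hb : ∀ i, Continuous fun t => b t i) (l : List Bool) :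
    Continuous fun t => radSum (b t) l := by
  unfold radSum
  exact continuous_finsetSum _ fun i _ => continuous_const.mul (hb i)

theorem continuous_trigTerm (m : ℕ) (a ψ : ℕ → ℝ) (i : ℕ) :
    Continuous fun t => trigTerm m a ψ t i := by
  unfold trigTerm
  fun_prop

theorem integral_cos_sq (n : ℕ) (hn : 1 ≤ n) (c : ℝ) :
    ∫ t in (0 : ℝ)..1, Real.cos (2 * Real.pi * n * t + c) ^ 2 = 1 / 2 := by
  have hn' : (n : ℝ) ≠ 0 := by positivity
  have hd : 2 * Real.pi * n ≠ 0 := by positivity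
  rw [intervalIntegral.integral_comp_mul_add (fun u => Real.cos u ^ 2) hd, _root_.integral_cos_sq]
  have h1 : 2 * Real.pi * n * 1 + c = c + n * (2 * Real.pi) := by ring
  simp only [h1, mul_zero, zero_add, Real.cos_add_nat_mul_two_pi, Real.sin_add_nat_mul_two_pi,
    smul_eq_mul]
  field_simp
  ring

/-- The mean over all signs of the `L¹` norm dominates the `ℓ²` norm of the amplitudes. -/
theorem le_sum_cube_integral {m : ℕ} (hm : 1 ≤ m) (a ψ : ℕ → ℝ) (r : ℕ) {s : ℝ} (hs : 0 < s)
    (hs2 : s ^ 2 = ∑ i ∈ Finset.range r, a i ^ 2) :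
    2 ^ r * (s / 18) ≤
      ∑ l ∈ cube r, ∫ t in (0 : ℝ)..1, |radSum (trigTerm m a ψ t) l| := by
  have hc := continuous_radSum (continuous_trigTerm m a ψ)
  have hint : ∀ l, IntervalIntegrable (fun t => |radSum (trigTerm m a ψ t) l|) volume 0 1 :=
    fun l => (hc l).abs.intervalIntegrable _ _
  rw [← intervalIntegral.integral_finsetSum fun l _ => hint l]
  have hct : ∀ i, Continuous fun t => trigTerm m a ψ t i ^ 2 :=
    fun i => (continuous_trigTerm m a ψ i).pow 2
  have hcs : Continuous fun t => ∑ i ∈ Finset.range r, trigTerm m a ψ t i ^ 2 :=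
    continuous_finsetSum _ fun i _ => hct i
  have hI : ∫ t in (0 : ℝ)..1, 2 ^ r * ((∑ i ∈ Finset.range r, trigTerm m a ψ t i ^ 2) / (3 * s) -
      s / 9) = 2 ^ r * (s / 18) := by
    have h1 : ∫ t in (0 : ℝ)..1, ∑ i ∈ Finset.range r, trigTerm m a ψ t i ^ 2 = s ^ 2 / 2 := by
      rw [intervalIntegral.integral_finsetSum fun i _ => (hct i).intervalIntegrable _ _, hs2,
        Finset.sum_div]
      refine Finset.sum_congr rfl fun i _ => ?_
      simp only [trigTerm, mul_pow, intervalIntegral.integral_const_mul]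
      rw [integral_cos_sq _ (by omega)]
      ring
    rw [intervalIntegral.integral_const_mul, intervalIntegral.integral_sub
      ((hcs.div_const _).intervalIntegrable _ _) (by simp), intervalIntegral.integral_div, h1]
    simp only [intervalIntegral.integral_const, sub_zero, one_smul]
    field_simp
    ring
  rw [← hI]
  refine intervalIntegral.integral_mono_on zero_le_one
    (((hcs.div_const _).sub continuous_const).const_mul _ |>.intervalIntegrable _ _)
    ((continuous_finsetSum _ fun l _ => (hc l).abs).intervalIntegrable _ _) fun t _ => ?_
  set b := trigTerm m a ψ t with hb
  set w := ∑ i ∈ Finset.range r, b i ^ 2 with hw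
  have hws : w ≤ s ^ 2 := by
    rw [hs2]
    refine Finset.sum_le_sum fun i _ => ?_
    rw [hb, trigTerm, mul_pow]
    exact mul_le_of_le_one_right (sq_nonneg _) (Real.cos_sq_le_one _)
  have hw0 : 0 ≤ w := Finset.sum_nonneg fun i _ => sq_nonneg _
  -- `y ≥ y² - y⁴` for `y ≥ 0`, applied to `y = |q| / (3s)`; with the scale `3s` the quadratic part
  -- contributes `s / 6` to the mean and the quartic part at most `s / 9`.
  have hpt : ∀ q : ℝ, q ^ 2 / (3 * s) - q ^ 4 / (27 * s ^ 3) ≤ |q| := by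
    intro q
    set y := |q| / (3 * s) with hy
    have hq : |q| = 3 * s * y := by rw [hy]; field_simp
    have hy0 : 0 ≤ y := by positivity
    have e2 : q ^ 2 = (3 * s * y) ^ 2 := by rw [← hq, sq_abs]
    have e4 : q ^ 4 = (3 * s * y) ^ 4 := by rw [← hq]; exact ((Even.pow_abs (by decide) q)).symm
    rw [e2, e4, hq]
    have : (3 * s * y) ^ 2 / (3 * s) - (3 * s * y) ^ 4 / (27 * s ^ 3) =
        3 * s * (y ^ 2 - y ^ 4) := by
      field_simp
      ring
    rw [this]
    have h3 : y ^ 2 - y ^ 4 ≤ y := by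
      rcases le_total y 1 with h | h
      · nlinarith [pow_nonneg hy0 4, mul_nonneg hy0 (sub_nonneg.2 h)]
      · have h3 : y ^ 2 ≤ y ^ 4 := pow_le_pow_right₀ h (by norm_num)
        linarith
    gcongr
  calc 2 ^ r * (w / (3 * s) - s / 9)
      ≤ (∑ l ∈ cube r, radSum b l ^ 2) / (3 * s) -
          (∑ l ∈ cube r, radSum b l ^ 4) / (27 * s ^ 3) := by
        have h4 : (∑ l ∈ cube r, radSum b l ^ 4) / (27 * s ^ 3) ≤ 2 ^ r * (s / 9) := by
          rw [div_le_iff₀ (by positivity)]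
          refine (sum_cube_radSum_pow_four_le r b).trans ?_
          rw [← hw]
          have : w ^ 2 ≤ (s ^ 2) ^ 2 := by gcongr
          calc (2 : ℝ) ^ r * (3 * w ^ 2) ≤ 2 ^ r * (3 * (s ^ 2) ^ 2) := by gcongr
            _ = _ := by ring
        rw [sum_cube_radSum_sq, ← hw, mul_sub, mul_div_assoc]
        linarith
    _ = ∑ l ∈ cube r, (radSum b l ^ 2 / (3 * s) - radSum b l ^ 4 / (27 * s ^ 3)) := by
        rw [Finset.sum_sub_distrib, Finset.sum_div, Finset.sum_div]
    _ ≤ _ := Finset.sum_le_sum fun l _ => hpt _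

/-- The second moment, over all signs, of the `L¹` norm. -/
theorem sum_cube_integral_sq_le (m : ℕ) (a ψ : ℕ → ℝ) (r : ℕ) :
    ∑ l ∈ cube r, (∫ t in (0 : ℝ)..1, |radSum (trigTerm m a ψ t) l|) ^ 2 ≤
      2 ^ r * ∑ i ∈ Finset.range r, a i ^ 2 := by
  have hc := continuous_radSum (continuous_trigTerm m a ψ)
  have hCS : ∀ l, (∫ t in (0 : ℝ)..1, |radSum (trigTerm m a ψ t) l|) ^ 2 ≤
      ∫ t in (0 : ℝ)..1, radSum (trigTerm m a ψ t) l ^ 2 := by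
    intro l
    set f := fun t => radSum (trigTerm m a ψ t) l with hf
    set c := ∫ t in (0 : ℝ)..1, |f t| with hcdef
    have hf2 : Continuous fun t => f t ^ 2 := (hc l).pow 2
    have hf1 : Continuous fun t => 2 * c * |f t| := (hc l).abs.const_mul _
    have hf3 : Continuous fun t => f t ^ 2 - 2 * c * |f t| := hf2.sub hf1
    have h0 : 0 ≤ ∫ t in (0 : ℝ)..1, (|f t| - c) ^ 2 :=
      intervalIntegral.integral_nonneg zero_le_one fun t _ => sq_nonneg _
    have h1 : ∫ t in (0 : ℝ)..1, (|f t| - c) ^ 2 = (∫ t in (0 : ℝ)..1, f t ^ 2) - c ^ 2 := by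
      have : ∀ t, (|f t| - c) ^ 2 = f t ^ 2 - 2 * c * |f t| + c ^ 2 := by
        intro t
        rw [sub_sq, sq_abs]
        ring
      simp only [this]
      rw [intervalIntegral.integral_add
        (hf3.intervalIntegrable _ _) (by simp),
        intervalIntegral.integral_sub (hf2.intervalIntegrable _ _)
        (hf1.intervalIntegrable _ _), intervalIntegral.integral_const_mul, ← hcdef]
      simp only [intervalIntegral.integral_const, sub_zero, one_smul]
      ring
    linarith
  refine (Finset.sum_le_sum fun l _ => hCS l).trans ?_
  have hc2 : ∀ l, Continuous fun t => radSum (trigTerm m a ψ t) l ^ 2 := fun l => (hc l).pow 2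
  rw [← intervalIntegral.integral_finsetSum fun l _ => (hc2 l).intervalIntegrable _ _]
  have hconst : (2 : ℝ) ^ r * ∑ i ∈ Finset.range r, a i ^ 2 =
      ∫ _ in (0 : ℝ)..1, (2 : ℝ) ^ r * ∑ i ∈ Finset.range r, a i ^ 2 := by simp
  rw [hconst]
  refine intervalIntegral.integral_mono_on zero_le_one
    ((continuous_finsetSum _ fun l _ => (hc l).pow 2).intervalIntegrable _ _) (by simp)
    fun t _ => ?_
  rw [sum_cube_radSum_sq]
  refine mul_le_mul_of_nonneg_left (Finset.sum_le_sum fun i _ => ?_) (by positivity)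
  rw [trigTerm, mul_pow]
  exact mul_le_of_le_one_right (sq_nonneg _) (Real.cos_sq_le_one _)

/-- Paley–Zygmund: for a fixed proportion of the signs, the `L¹` norm is at least a fixed multiple
of the `ℓ²` norm of the amplitudes. -/
theorem card_small_integral_le {m : ℕ} (hm : 1 ≤ m) (a ψ : ℕ → ℝ) (r : ℕ) {s : ℝ} (hs : 0 < s)
    (hs2 : s ^ 2 = ∑ i ∈ Finset.range r, a i ^ 2) :
    1296 * ((cube r).filter fun l =>
      ∫ t in (0 : ℝ)..1, |radSum (trigTerm m a ψ t) l| ≤ s / 36).card ≤ 1295 * 2 ^ r := by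
  set f : List Bool → ℝ := fun l => ∫ t in (0 : ℝ)..1, |radSum (trigTerm m a ψ t) l| with hf
  have h1 := le_sum_cube_integral hm a ψ r hs hs2
  have h2 := sum_cube_integral_sq_le m a ψ r
  rw [← hs2] at h2
  set A := (cube r).filter fun l => f l ≤ s / 36 with hA
  set B := (cube r).filter fun l => ¬ f l ≤ s / 36 with hB
  have hAB : (A.card : ℝ) + B.card = 2 ^ r := by
    have := Finset.card_filter_add_card_filter_not (s := cube r) fun l => f l ≤ s / 36
    rw [card_cube] at this
    exact_mod_cast this
  have hsplit : ∑ l ∈ cube r, f l = ∑ l ∈ A, f l + ∑ l ∈ B, f l :=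
    (Finset.sum_filter_add_sum_filter_not _ _ _).symm
  have hAle : ∑ l ∈ A, f l ≤ A.card * (s / 36) := by
    rw [← nsmul_eq_mul]
    exact Finset.sum_le_card_nsmul _ _ _ fun l hl => (Finset.mem_filter.1 hl).2
  have hBle : ∑ l ∈ B, f l ≤ 2 ^ r * (s / 72) + B.card * (18 * s) := by
    -- AM-GM with the weight that makes the quadratic part half of the gap left by the mean
    have hpt : ∀ l, f l ≤ f l ^ 2 / (72 * s) + 18 * s := by
      intro l
      have h : f l ^ 2 / (72 * s) + 18 * s - f l = (f l - 36 * s) ^ 2 / (72 * s) := by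
        field_simp
        ring
      have : 0 ≤ (f l - 36 * s) ^ 2 / (72 * s) := by positivity
      linarith
    calc ∑ l ∈ B, f l ≤ ∑ l ∈ B, (f l ^ 2 / (72 * s) + 18 * s) := Finset.sum_le_sum fun l _ => hpt l
      _ = (∑ l ∈ B, f l ^ 2) / (72 * s) + B.card * (18 * s) := by
        rw [Finset.sum_add_distrib, Finset.sum_div, Finset.sum_const, nsmul_eq_mul]
      _ ≤ (2 ^ r * s ^ 2) / (72 * s) + B.card * (18 * s) := by
        gcongr
        refine le_trans ?_ h2
        exact Finset.sum_le_sum_of_subset_of_nonneg (Finset.filter_subset _ _)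
          fun _ _ _ => sq_nonneg _
      _ = _ := by
        field_simp
  have hA2 : (A.card : ℝ) * (s / 36) ≤ 2 ^ r * (s / 36) := by
    gcongr
    have : (0 : ℝ) ≤ B.card := by positivity
    linarith
  have h3 : (2 : ℝ) ^ r * (s / 72) ≤ B.card * (18 * s) := by
    have : (2 : ℝ) ^ r * (s / 18) = 2 ^ r * (s / 36) + 2 ^ r * (s / 72) + 2 ^ r * (s / 72) := by
      ring
    linarith
  have h4 : (2 : ℝ) ^ r ≤ 1296 * B.card := by
    have : s * 2 ^ r ≤ s * (1296 * B.card) := by linarith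
    exact le_of_mul_le_mul_left this hs
  have h5 : (1296 : ℝ) * A.card ≤ 1295 * 2 ^ r := by linarith
  exact_mod_cast h5

/-! ### Compressing the branches of a sparse tree -/

theorem primrec_two_pow : Primrec fun n : ℕ => 2 ^ n :=
  (Primrec₂.unpaired'.1 Nat.Primrec.pow).comp (.const 2) .id

theorem primrec_strings : Primrec strings := by
  refine (Primrec.nat_rec₁ (f := fun (_ : ℕ) (L : List (List Bool)) =>
    L.map (List.cons true) ++ L.map (List.cons false)) [[]] ?_).of_eq fun r => ?_
  · exact Primrec.list_append.comp
      (Primrec.list_map Primrec.snd (Primrec.list_cons.comp (Primrec.const true) Primrec.snd).to₂)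
      (Primrec.list_map Primrec.snd (Primrec.list_cons.comp (Primrec.const false) Primrec.snd).to₂)
  · induction r with
    | zero => rfl
    | succ r ih => rw [strings, ← ih]

theorem eq_replicate_append {p : List Bool} (h : p.idxOf false < p.length) :
    p = List.replicate (p.idxOf false) true ++ false :: p.drop (p.idxOf false + 1) := by
  induction p with
  | nil => simp at h
  | cons b p ih =>
    cases b with
    | false => simp
    | true =>
      have hne : (true :: p).idxOf false = p.idxOf false + 1 := by
        rw [List.idxOf_cons_ne _ (by decide)]
      rw [hne] at h ⊢
      simp only [List.length_cons, add_lt_add_iff_right] at h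
      simpa [List.replicate_succ] using ih h

theorem idxOf_replicate_append (k : ℕ) (q : List Bool) :
    (List.replicate k true ++ false :: q).idxOf false = k := by
  induction k with
  | zero => simp
  | succ k ih => rw [List.replicate_succ, List.cons_append, List.idxOf_cons_ne _ (by decide), ih]

/-- The decoder used to compress a tree of small density. On the program `1 ⋯ 1 0 q` with `k` ones
it reads `q` as an index and looks it up in the level `n k` of the tree `T`; it accepts only indices
of exactly `n k - 2 k` bits. -/
def treeDecoder (T : ℕ → List (List Bool)) (n : ℕ → ℕ) (p : List Bool) : Option (List Bool) :=
  if p.idxOf false < p.length ∧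
      (p.drop (p.idxOf false + 1)).length = n (p.idxOf false) - 2 * p.idxOf false then
    (T (n (p.idxOf false)))[(strings (n (p.idxOf false) - 2 * p.idxOf false)).idxOf
      (p.drop (p.idxOf false + 1))]?
  else none

theorem computable_treeDecoder {T : ℕ → List (List Bool)} {n : ℕ → ℕ} (hT : Computable T)
    (hn : Computable n) : Computable (treeDecoder T n) := by
  have hk : Computable fun p : List Bool => p.idxOf false :=
    (Primrec.list_idxOf.comp (Primrec.const false) Primrec.id).to_comp
  have hq : Computable fun p : List Bool => p.drop (p.idxOf false + 1) :=
    Primrec.list_drop.to_comp.comp (Computable.succ.comp hk) Computable.id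
  have hnk : Computable fun p : List Bool => n (p.idxOf false) := hn.comp hk
  have hr : Computable fun p : List Bool => n (p.idxOf false) - 2 * p.idxOf false :=
    Primrec.nat_sub.to_comp.comp hnk (Primrec.nat_double.to_comp.comp hk)
  have h1 : Computable fun p : List Bool => decide (p.idxOf false < p.length) :=
    (Primrec.nat_lt.decide.to_comp).comp hk Computable.list_length
  have h2 : Computable fun p : List Bool => decide ((p.drop (p.idxOf false + 1)).length =
      n (p.idxOf false) - 2 * p.idxOf false) :=
    (Primrec.eq.decide.to_comp).comp (Computable.list_length.comp hq) hr
  have h3 := Computable.cond (Primrec.and.to_comp.comp h1 h2)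
    (Computable.list_getElem?.comp (hT.comp hnk)
      (Primrec.list_idxOf.to_comp.comp hq (primrec_strings.to_comp.comp hr)))
    (Computable.const none)
  refine h3.of_eq fun p => ?_
  rw [treeDecoder, ← Bool.decide_and, Bool.cond_decide]
  congr!

theorem isPrefixFreeMachine_treeDecoder {T : ℕ → List (List Bool)} {n : ℕ → ℕ} (hT : Computable T)
    (hn : Computable n) : IsPrefixFreeMachine fun p => (treeDecoder T n p : Part (List Bool)) := by
  refine ⟨(computable_treeDecoder hT hn).ofOption, fun p q hp hq hpq => ?_⟩
  have key : ∀ p, (treeDecoder T n p : Part (List Bool)).Dom → p.idxOf false < p.length ∧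
      (p.drop (p.idxOf false + 1)).length = n (p.idxOf false) - 2 * p.idxOf false := by
    intro p hp
    by_contra h
    rw [treeDecoder, if_neg h] at hp
    exact hp
  obtain ⟨hp1, hp2⟩ := key p hp
  obtain ⟨hq1, hq2⟩ := key q hq
  have hpe := eq_replicate_append hp1
  have hqe := eq_replicate_append hq1
  rw [hpe, hqe] at hpq
  obtain ⟨hk, hpre⟩ := replicate_prefix hpq
  rw [hk] at hp2
  have := hpre.eq_of_length (by rw [hk, hp2, hq2])
  rw [hpe, hqe, hk, ← hk, this]
  simp [hk]

theorem length_initialSegment (α : ℕ → Bool) (n : ℕ) : (initialSegment α n).length = n := by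
  simp [initialSegment]

/-- A computable tree of strings whose density tends to zero has no complex branch: a branch is
described by its index in a level of small density, which saves `2 k` bits, and by the number `k`
that locates this level. -/
theorem notMem_KC_of_tree {T : ℕ → List (List Bool)} (hT : Computable T)
    (hsmall : ∀ k, ∃ n, 2 * k ≤ n ∧ (T n).length * 2 ^ (2 * k) ≤ 2 ^ n)
    {α : ℕ → Bool} (hα : ∀ n, initialSegment α n ∈ T n) : α ∉ KC := by
  rintro ⟨d, hd⟩
  obtain ⟨n, hn, hspec⟩ : ∃ n : ℕ → ℕ, Computable n ∧
      ∀ k, 2 * k ≤ n k ∧ (T (n k)).length * 2 ^ (2 * k) ≤ 2 ^ n k := by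
    have hpow : Computable fun n : ℕ => 2 ^ n := primrec_two_pow.to_comp
    have h2k : Computable fun p : ℕ × ℕ => 2 * p.1 := Primrec.nat_double.to_comp.comp Computable.fst
    have hlen : Computable fun p : ℕ × ℕ => (T p.2).length * 2 ^ (2 * p.1) :=
      Primrec.nat_mul.to_comp.comp (Computable.list_length.comp (hT.comp Computable.snd))
        (hpow.comp h2k)
    have hP : ComputablePred fun p : ℕ × ℕ =>
        2 * p.1 ≤ p.2 ∧ (T p.2).length * 2 ^ (2 * p.1) ≤ 2 ^ p.2 := by
      rw [ComputablePred.computable_iff]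
      refine ⟨_, Primrec.and.to_comp.comp
        (Primrec.nat_le.decide.to_comp.comp h2k Computable.snd)
        (Primrec.nat_le.decide.to_comp.comp hlen (hpow.comp Computable.snd)), ?_⟩
      simp
    exact ⟨_, Computable.find hP hsmall, fun k => Nat.find_spec (hsmall k)⟩
  obtain ⟨c, hc⟩ := isOptimalMachine_universalMachine.optimal _
    (isPrefixFreeMachine_treeDecoder hT hn)
  set k := c + d + 2 with hk
  obtain ⟨h2k, hcard⟩ := hspec k
  set a := initialSegment α (n k) with ha
  set r := n k - 2 * k with hr
  have hidx : (T (n k)).idxOf a < (T (n k)).length := List.idxOf_lt_length_of_mem (hα _)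
  have hlt : (T (n k)).idxOf a < (strings r).length := by
    refine hidx.trans_le ?_
    rw [length_strings]
    have : 2 ^ n k = 2 ^ r * 2 ^ (2 * k) := by rw [← pow_add]; congr 1; omega
    rw [this] at hcard
    exact Nat.le_of_mul_le_mul_right hcard (by positivity)
  set q := (strings r)[(T (n k)).idxOf a] with hq
  have hqlen : q.length = r := mem_strings.1 (List.getElem_mem hlt)
  have hmem : a ∈ (treeDecoder T n (List.replicate k true ++ false :: q) : Part (List Bool)) := by
    have hdrop : (List.replicate k true ++ false :: q).drop (k + 1) = q := by
      rw [List.drop_append]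
      simp
    rw [treeDecoder, idxOf_replicate_append, hdrop, if_pos ⟨by simp, hqlen⟩, ← hr, hq,
      (nodup_strings r).idxOf_getElem]
    simp [List.getElem?_eq_getElem hidx]
  obtain ⟨p, hp, hplen⟩ := hc _ _ hmem
  have hK : kolmogorovComplexity a ≤ (p.length : ℕ∞) := iInf₂_le p hp
  have h1 : (n k : ℕ∞) ≤ ((p.length + d : ℕ) : ℕ∞) := by
    refine (hd (n k)).trans ?_
    push_cast
    gcongr
  have h2 : n k ≤ p.length + d := by exact_mod_cast h1
  simp only [List.length_append, List.length_replicate, List.length_cons, hqlen] at hplen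
  omega

/-! ### Codes of rational numbers -/

/-- A code of a rational number: `(u, v, b)` stands for `(u - v) / (b + 1)`. Two
natural numbers serve as numerator to avoid integers, and the shift keeps the denominator positive;
codes are not reduced, so that a rational has many of them. -/
abbrev RatCode := ℕ × ℕ × ℕ

namespace RatCode

/-- The number that a code stands for. -/
noncomputable def val (q : RatCode) : ℝ := ((q.1 : ℝ) - q.2.1) / (q.2.2 + 1)

/-- Addition of codes. -/
def add (p q : RatCode) : RatCode :=
  (p.1 * (q.2.2 + 1) + q.1 * (p.2.2 + 1), p.2.1 * (q.2.2 + 1) + q.2.1 * (p.2.2 + 1),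
    p.2.2 * q.2.2 + p.2.2 + q.2.2)

/-- Multiplication of codes. -/
def mul (p q : RatCode) : RatCode :=
  (p.1 * q.1 + p.2.1 * q.2.1, p.1 * q.2.1 + p.2.1 * q.1, p.2.2 * q.2.2 + p.2.2 + q.2.2)

/-- Absolute value of codes. -/
def abs (p : RatCode) : RatCode := ((p.1 - p.2.1) + (p.2.1 - p.1), 0, p.2.2)

/-- The code of `1 / d`; that of `0` for `d = 0`. -/
def inv (d : ℕ) : RatCode := (min d 1, 0, d - 1)

theorem val_add (p q : RatCode) : val (add p q) = val p + val q := by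
  simp only [val, add]
  push_cast
  field_simp
  ring

theorem val_mul (p q : RatCode) : val (mul p q) = val p * val q := by
  simp only [val, mul]
  push_cast
  field_simp
  ring

theorem val_abs (p : RatCode) : val (abs p) = |val p| := by
  have hb : (0 : ℝ) < p.2.2 + 1 := by positivity
  simp only [val, abs]
  rw [abs_div, abs_of_pos hb]
  congr 1
  rcases le_total p.1 p.2.1 with h | h
  · rw [Nat.sub_eq_zero_of_le h, abs_of_nonpos (by simpa using h)]
    push_cast [h]
    ring
  · rw [Nat.sub_eq_zero_of_le h, abs_of_nonneg (by simpa using h)]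
    push_cast [h]
    ring

theorem val_inv (d : ℕ) : val (inv d) = (d : ℝ)⁻¹ := by
  rcases Nat.eq_zero_or_pos d with rfl | h
  · simp [val, inv]
  · have h1 : (((d - 1 : ℕ) : ℝ) + 1) = d := by rw [Nat.cast_sub h]; simp
    simp [val, inv, Nat.min_eq_right h, h1]

theorem val_natCast (n : ℕ) : val (n, 0, 0) = n := by simp [val]

theorem abs_val_le (p : RatCode) : |val p| ≤ ((p.1 + p.2.1 : ℕ) : ℝ) := by
  have hb : (1 : ℝ) ≤ p.2.2 + 1 := by simp
  rw [val, abs_div, abs_of_pos (by positivity : (0 : ℝ) < p.2.2 + 1)]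
  refine (div_le_self (abs_nonneg _) hb).trans ?_
  push_cast
  rw [abs_le]
  constructor <;> linarith [Nat.cast_nonneg (α := ℝ) p.1, Nat.cast_nonneg (α := ℝ) p.2.1]

theorem val_le_iff (p : RatCode) (n : ℕ) : val p ≤ n ↔ p.1 ≤ p.2.1 + n * (p.2.2 + 1) := by
  rw [val, div_le_iff₀ (by positivity), sub_le_iff_le_add']
  exact_mod_cast Iff.rfl

section

open Primrec

theorem primrec_add : Primrec₂ add := by
  have b1 : Primrec fun x : RatCode × RatCode => x.1.2.2 := snd.comp (snd.comp fst)
  have b2 : Primrec fun x : RatCode × RatCode => x.2.2.2 := snd.comp (snd.comp snd)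
  have v1 : Primrec fun x : RatCode × RatCode => x.1.2.1 := fst.comp (snd.comp fst)
  have v2 : Primrec fun x : RatCode × RatCode => x.2.2.1 := fst.comp (snd.comp snd)
  have u1 : Primrec fun x : RatCode × RatCode => x.1.1 := fst.comp fst
  have u2 : Primrec fun x : RatCode × RatCode => x.2.1 := fst.comp snd
  exact Primrec.pair
    (nat_add.comp (nat_mul.comp u1 (succ.comp b2)) (nat_mul.comp u2 (succ.comp b1)))
    (Primrec.pair
      (nat_add.comp (nat_mul.comp v1 (succ.comp b2)) (nat_mul.comp v2 (succ.comp b1)))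
      (nat_add.comp (nat_add.comp (nat_mul.comp b1 b2) b1) b2))

theorem primrec_mul : Primrec₂ mul := by
  have b1 : Primrec fun x : RatCode × RatCode => x.1.2.2 := snd.comp (snd.comp fst)
  have b2 : Primrec fun x : RatCode × RatCode => x.2.2.2 := snd.comp (snd.comp snd)
  have v1 : Primrec fun x : RatCode × RatCode => x.1.2.1 := fst.comp (snd.comp fst)
  have v2 : Primrec fun x : RatCode × RatCode => x.2.2.1 := fst.comp (snd.comp snd)
  have u1 : Primrec fun x : RatCode × RatCode => x.1.1 := fst.comp fst
  have u2 : Primrec fun x : RatCode × RatCode => x.2.1 := fst.comp snd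
  exact Primrec.pair
    (nat_add.comp (nat_mul.comp u1 u2) (nat_mul.comp v1 v2))
    (Primrec.pair
      (nat_add.comp (nat_mul.comp u1 v2) (nat_mul.comp v1 u2))
      (nat_add.comp (nat_add.comp (nat_mul.comp b1 b2) b1) b2))

theorem primrec_abs : Primrec abs := by
  have u : Primrec fun x : RatCode => x.1 := fst
  have v : Primrec fun x : RatCode => x.2.1 := fst.comp snd
  exact Primrec.pair (nat_add.comp (nat_sub.comp u v) (nat_sub.comp v u))
    (Primrec.pair (Primrec.const 0) (snd.comp snd))

theorem primrec_inv : Primrec inv :=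
  Primrec.pair (nat_min.comp .id (.const 1)) (.pair (.const 0) (nat_sub.comp .id (.const 1)))

end

end RatCode

open RatCode

/-! ### Computable families of reals -/

/-- A family of reals is computable if rationals computed from the index and `k` approximate its
members up to `2 ^ (-k)`. -/
def ComputableFamily {A : Type*} [Primcodable A] (f : A → ℝ) : Prop :=
  ∃ g : A → ℕ → RatCode, Computable₂ g ∧ ∀ a k, |f a - val (g a k)| ≤ 1 / 2 ^ k

namespace ComputableFamily

variable {A B : Type*} [Primcodable A] [Primcodable B] {f f' : A → ℝ}

theorem comp {h : B → A} (hf : ComputableFamily f) (hh : Computable h) :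
    ComputableFamily fun b => f (h b) := by
  obtain ⟨g, hg, h'⟩ := hf
  exact ⟨fun b => g (h b), hg.comp (hh.comp .fst) .snd, fun b => h' (h b)⟩

theorem val {q : A → RatCode} (hq : Computable q) : ComputableFamily fun a => RatCode.val (q a) :=
  ⟨fun a _ => q a, hq.comp .fst, fun a k => by simp⟩

theorem natCast {n : A → ℕ} (hn : Computable n) : ComputableFamily fun a => (n a : ℝ) := by
  have := val (hn.pair (.const ((0, 0) : ℕ × ℕ)))
  simpa only [val_natCast] using this

theorem inv_natCast {n : A → ℕ} (hn : Computable n) : ComputableFamily fun a => (n a : ℝ)⁻¹ := by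
  have := val (primrec_inv.to_comp.comp hn)
  simpa only [val_inv] using this

theorem add (hf : ComputableFamily f) (hf' : ComputableFamily f') :
    ComputableFamily fun a => f a + f' a := by
  obtain ⟨g, hg, h⟩ := hf
  obtain ⟨g', hg', h'⟩ := hf'
  refine ⟨fun a k => RatCode.add (g a (k + 1)) (g' a (k + 1)), ?_, fun a k => ?_⟩
  · exact primrec_add.to_comp.comp (hg.comp .fst (Computable.succ.comp .snd))
      (hg'.comp .fst (Computable.succ.comp .snd))
  · have h1 := h a (k + 1)
    have h2 := h' a (k + 1)
    have h3 : (1 : ℝ) / 2 ^ k = 1 / 2 ^ (k + 1) + 1 / 2 ^ (k + 1) := by rw [pow_succ]; ring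
    rw [val_add, h3, add_sub_add_comm]
    exact (abs_add_le _ _).trans (add_le_add h1 h2)

theorem abs (hf : ComputableFamily f) : ComputableFamily fun a => |f a| := by
  obtain ⟨g, hg, h⟩ := hf
  refine ⟨fun a k => RatCode.abs (g a k), primrec_abs.to_comp.comp hg, fun a k => ?_⟩
  rw [val_abs]
  exact (abs_abs_sub_abs_le_abs_sub _ _).trans (h a k)

theorem exists_bound (hf : ComputableFamily f) :
    ∃ M : A → ℕ, Computable M ∧ ∀ a, |f a| ≤ M a := by
  obtain ⟨g, hg, h⟩ := hf
  have hg0 : Computable fun a => g a 0 := hg.comp .id (.const 0)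
  refine ⟨fun a => (g a 0).1 + (g a 0).2.1 + 1, ?_, fun a => ?_⟩
  · exact Computable.succ.comp (Primrec.nat_add.to_comp.comp (Computable.fst.comp hg0)
      (Computable.fst.comp (Computable.snd.comp hg0)))
  · have h1 := h a 0
    have h2 := abs_val_le (g a 0)
    have h3 := abs_sub_abs_le_abs_sub (f a) (RatCode.val (g a 0))
    push_cast at h2 ⊢
    norm_num at h1
    linarith

theorem mul (hf : ComputableFamily f) (hf' : ComputableFamily f') :
    ComputableFamily fun a => f a * f' a := by
  obtain ⟨M, hM, hfM⟩ := hf.exists_bound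
  obtain ⟨M', hM', hfM'⟩ := hf'.exists_bound
  obtain ⟨g, hg, h⟩ := hf
  obtain ⟨g', hg', h'⟩ := hf'
  -- a precision at which the error is at most `(M + M' + 1) / 2 ^ (M + M' + 1 + k)`
  set P : A → ℕ → ℕ := fun a k => M a + M' a + 1 + k with hP
  have hPc : Computable₂ P :=
    Primrec.nat_add.to_comp.comp (Computable.succ.comp
      (Primrec.nat_add.to_comp.comp (hM.comp .fst) (hM'.comp .fst))) .snd
  refine ⟨fun a k => RatCode.mul (g a (P a k)) (g' a (P a k)), ?_, fun a k => ?_⟩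
  · exact primrec_mul.to_comp.comp (hg.comp .fst hPc) (hg'.comp .fst hPc)
  · rw [val_mul]
    set e : ℝ := 1 / 2 ^ P a k with he
    have he0 : 0 < e := by positivity
    have he1 : e ≤ 1 := by
      rw [he, div_le_one (by positivity)]
      exact one_le_pow₀ (by norm_num)
    have h1 := h a (P a k)
    have h2 := h' a (P a k)
    set p := RatCode.val (g a (P a k))
    set p' := RatCode.val (g' a (P a k))
    have hp : |p| ≤ M a + 1 := by
      have := abs_sub_abs_le_abs_sub p (f a)
      rw [abs_sub_comm] at this
      linarith [hfM a]
    have hkey : |f a * f' a - p * p'| ≤ (M a + M' a + 1) * e := by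
      have : f a * f' a - p * p' = (f a - p) * f' a + p * (f' a - p') := by ring
      rw [this]
      refine (abs_add_le _ _).trans ?_
      rw [abs_mul, abs_mul]
      have i1 : |f a - p| * |f' a| ≤ e * M' a := by gcongr; exact hfM' a
      have i2 : |p| * |f' a - p'| ≤ (M a + 1) * e := by gcongr
      linarith
    refine hkey.trans ?_
    have hlt : ((M a + M' a + 1 : ℕ) : ℝ) ≤ 2 ^ (M a + M' a + 1) := by
      exact_mod_cast (Nat.lt_two_pow_self).le
    push_cast at hlt
    rw [he, hP, pow_add _ (M a + M' a + 1), mul_one_div, div_le_div_iff₀ (by positivity)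
      (by positivity), one_mul]
    gcongr

theorem sum {F : A → ℕ → ℝ} (hF : ComputableFamily fun x : A × ℕ => F x.1 x.2) {n : A → ℕ}
    (hn : Computable n) : ComputableFamily fun a => ∑ i ∈ Finset.range (n a), F a i := by
  obtain ⟨g, hg, h⟩ := hF
  -- each of the `n` summands is computed up to `2 ^ (-(n + k))`
  let S : A → ℕ → ℕ → RatCode := fun a k m =>
    Nat.rec (0, 0, 0) (fun i s => RatCode.add s (g (a, i) (n a + k))) m
  have hS : Computable₂ fun a k => S a k (n a) := by
    refine Computable.nat_rec (f := fun x : A × ℕ => n x.1)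
      (g := fun _ => ((0, 0, 0) : RatCode))
      (h := fun x p => RatCode.add p.2 (g (x.1, p.1) (n x.1 + x.2)))
      (hn.comp .fst) (.const _) ?_
    have ha : Computable fun x : (A × ℕ) × ℕ × RatCode => x.1.1 := Computable.fst.comp .fst
    have hk : Computable fun x : (A × ℕ) × ℕ × RatCode => x.1.2 := Computable.snd.comp .fst
    have hi : Computable fun x : (A × ℕ) × ℕ × RatCode => x.2.1 := Computable.fst.comp .snd
    have hs : Computable fun x : (A × ℕ) × ℕ × RatCode => x.2.2 := Computable.snd.comp .snd
    exact primrec_add.to_comp.comp hs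
      (hg.comp (ha.pair hi) (Primrec.nat_add.to_comp.comp (hn.comp ha) hk))
  refine ⟨_, hS, fun a k => ?_⟩
  have key : ∀ m, |∑ i ∈ Finset.range m, F a i - RatCode.val (S a k m)| ≤
      m * (1 / 2 ^ (n a + k)) := by
    intro m
    induction m with
    | zero => simp [S, RatCode.val]
    | succ m ih =>
      have hs : S a k (m + 1) = RatCode.add (S a k m) (g (a, m) (n a + k)) := rfl
      rw [Finset.sum_range_succ, hs, val_add, add_sub_add_comm]
      refine (abs_add_le _ _).trans ((add_le_add ih (h (a, m) _)).trans (le_of_eq ?_))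
      push_cast
      ring
  refine (key _).trans ?_
  have hlt : (n a : ℝ) ≤ 2 ^ n a := by exact_mod_cast (Nat.lt_two_pow_self).le
  rw [pow_add, mul_one_div, div_le_div_iff₀ (by positivity) (by positivity), one_mul]
  gcongr

end ComputableFamily

theorem IsComputableSeq.computableFamily {x : ℕ → ℝ} (hx : IsComputableSeq x) :
    ComputableFamily x := by
  obtain ⟨s, a, b, hs, ha, hb, hb0, h⟩ := hx
  have hodd : Computable₂ fun n k => (s n k).bodd := Computable.nat_bodd.comp hs
  refine ⟨fun n k => bif (s n k).bodd then (0, a n k, (b n k).pred) else (a n k, 0, (b n k).pred),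
    ?_, fun n k => ?_⟩
  · exact Computable.cond hodd
      (Computable.pair (.const 0) (Computable.pair ha (Computable.pred.comp hb)))
      (Computable.pair ha (Computable.pair (.const 0) (Computable.pred.comp hb)))
  · have hbk : (((b n k).pred : ℕ) : ℝ) + 1 = b n k := by
      exact_mod_cast Nat.succ_pred_eq_of_ne_zero (hb0 n k)
    refine (le_of_eq ?_).trans (h n k)
    congr 2
    beta_reduce
    rcases Nat.even_or_odd (s n k) with he | ho
    · have : (s n k).bodd = false := by
        rw [Nat.even_iff, Nat.mod_two_of_bodd] at he
        cases hbb : (s n k).bodd <;> simp_all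
      rw [this, he.neg_one_pow, cond_false, val, hbk]
      simp
    · have : (s n k).bodd = true := by
        rw [Nat.odd_iff, Nat.mod_two_of_bodd] at ho
        cases hbb : (s n k).bodd <;> simp_all
      rw [this, ho.neg_one_pow, cond_true, val, hbk]
      simp

/-! ### Computing the cosine -/

/-- The error made by one doubling of the angle of an approximate cosine. -/
theorem abs_sub_double_le {c d e : ℝ} (hc : |c| ≤ 1) (hcd : |c - d| ≤ e) (he : e ≤ 1) :
    |(2 * c ^ 2 - 1) - (2 * d ^ 2 - 1)| ≤ 6 * e := by
  have h1 : (2 * c ^ 2 - 1) - (2 * d ^ 2 - 1) = 2 * ((c - d) * (c + d)) := by ring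
  have h2 : |c + d| ≤ 3 := by
    have : c + d = 2 * c - (c - d) := by ring
    rw [this]
    refine (abs_sub _ _).trans ?_
    rw [abs_mul, abs_two]
    linarith
  have h0 : 0 ≤ e := (abs_nonneg _).trans hcd
  rw [h1, abs_mul, abs_mul, abs_two]
  have : |c - d| * |c + d| ≤ e * 3 := by gcongr
  linarith

/-- The approximation of `cos y` got from the quadratic Taylor polynomial at `y / 2 ^ r` by `r`
doublings of the angle. -/
noncomputable def cosApprox (r : ℕ) (y : ℝ) : ℝ :=
  (fun c => 2 * c ^ 2 - 1)^[r] (1 - (y / 2 ^ r) ^ 2 / 2)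

/-- Each doubling multiplies the error by at most `6`, whereas the error of the Taylor polynomial
gains a factor of `16` with each halving of the argument; this leaves `y ^ 4 * 2 ^ (-r)`. -/
theorem abs_cos_sub_cosApprox_le {B k r : ℕ} {y : ℝ} (hy : |y| ≤ B) (hr : r = k + 4 * B) :
    |Real.cos y - cosApprox r y| ≤ 1 / 2 ^ k := by
  have hB : (B : ℝ) ≤ 2 ^ B := by exact_mod_cast (Nat.lt_two_pow_self).le
  have hyB : |y| ≤ 2 ^ B := hy.trans hB
  set z := y / 2 ^ r with hz
  have hz1 : |z| ≤ 1 := by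
    rw [hz, abs_div, abs_of_pos (by positivity : (0 : ℝ) < 2 ^ r), div_le_one (by positivity)]
    exact hyB.trans (pow_le_pow_right₀ (by norm_num) (by omega))
  set e := |z| ^ 4 * (5 / 96) with he
  have he0 : 0 ≤ e := by positivity
  have hfin : 6 ^ r * e ≤ 1 / 2 ^ k := by
    have h1 : |z| ^ 4 ≤ 2 ^ (4 * B) / 16 ^ r := by
      rw [hz, abs_div, abs_of_pos (by positivity : (0 : ℝ) < 2 ^ r), div_pow, ← pow_mul, mul_comm r,
        pow_mul 2 4 r, mul_comm 4 B, pow_mul]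
      norm_num
      gcongr
    have h2 : (6 : ℝ) ^ r * 2 ^ r ≤ 16 ^ r := by
      rw [← mul_pow]
      gcongr
      norm_num
    have h3 : (2 : ℝ) ^ r = 2 ^ k * 2 ^ (4 * B) := by rw [hr, pow_add]
    rw [le_div_iff₀ (by positivity)]
    calc 6 ^ r * e * 2 ^ k ≤ 6 ^ r * (2 ^ (4 * B) / 16 ^ r * 1) * 2 ^ k := by
          rw [he]
          gcongr
          norm_num
      _ = (6 ^ r * 2 ^ r) / 16 ^ r := by rw [h3]; ring
      _ ≤ 1 := (div_le_one (by positivity)).2 h2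
  have h1k : (1 : ℝ) / 2 ^ k ≤ 1 := by
    rw [div_le_one (by positivity)]
    exact one_le_pow₀ (by norm_num)
  have key : ∀ j ≤ r, |Real.cos (2 ^ j * z) - (fun c => 2 * c ^ 2 - 1)^[j] (1 - z ^ 2 / 2)| ≤
      6 ^ j * e := by
    intro j hj
    induction j with
    | zero => simpa using Real.cos_bound hz1
    | succ j ih =>
      have hle : 6 ^ j * e ≤ 1 := by
        refine le_trans ?_ (hfin.trans h1k)
        gcongr
        · norm_num
        · omega
      have h := abs_sub_double_le (Real.abs_cos_le_one _) (ih (by omega)) hle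
      rw [Function.iterate_succ_apply', pow_succ', mul_assoc, Real.cos_two_mul, pow_succ' 6,
        mul_assoc]
      exact h
  have hyz : 2 ^ r * z = y := by rw [hz]; field_simp
  have := (key r le_rfl).trans hfin
  rwa [hyz] at this

/-- The doubling of the angle, on codes of rationals. -/
def codeDouble (c : RatCode) : RatCode :=
  RatCode.add (RatCode.mul (2, 0, 0) (RatCode.mul c c)) (0, 1, 0)

/-- The approximation `cosApprox` of the cosine, on codes of rationals. -/
def codeCos (r : ℕ) (q : RatCode) : RatCode :=
  codeDouble^[r] (RatCode.add (1, 0, 0)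
    (RatCode.mul (0, 1, 1) (RatCode.mul (RatCode.mul q (RatCode.inv (2 ^ r)))
      (RatCode.mul q (RatCode.inv (2 ^ r))))))

theorem val_codeCos (r : ℕ) (q : RatCode) : val (codeCos r q) = cosApprox r (val q) := by
  have h : Function.Semiconj val codeDouble fun c => 2 * c ^ 2 - 1 := by
    intro c
    simp only [codeDouble, val_add, val_mul]
    simp only [val]
    push_cast
    ring
  rw [codeCos, (h.iterate_right r).eq, cosApprox]
  congr 1
  simp only [val_add, val_mul, val_inv]
  simp only [val]
  push_cast
  ring

theorem computable_codeCos : Computable₂ codeCos := by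
  have hd : Primrec codeDouble :=
    primrec_add.comp (primrec_mul.comp (.const _) (primrec_mul.comp .id .id)) (.const _)
  have hz : Primrec fun x : ℕ × RatCode => RatCode.mul x.2 (RatCode.inv (2 ^ x.1)) :=
    primrec_mul.comp .snd (primrec_inv.comp (primrec_two_pow.comp .fst))
  exact (Primrec.nat_iterate .fst (primrec_add.comp (.const _) (primrec_mul.comp (.const _)
    (primrec_mul.comp hz hz))) (hd.comp .snd).to₂).to_comp

theorem ComputableFamily.cos {A : Type*} [Primcodable A] {f : A → ℝ} (hf : ComputableFamily f) :
    ComputableFamily fun a => Real.cos (f a) := by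
  obtain ⟨g, hg, h⟩ := hf
  let B : A → ℕ → ℕ := fun a k => (g a (k + 1)).1 + (g a (k + 1)).2.1
  have hg1 : Computable₂ fun a k => g a (k + 1) := hg.comp .fst (Computable.succ.comp .snd)
  have hB : Computable₂ B :=
    Primrec.nat_add.to_comp.comp (Computable.fst.comp hg1) (Computable.fst.comp
      (Computable.snd.comp hg1))
  refine ⟨fun a k => codeCos (k + 1 + 4 * B a k) (g a (k + 1)), ?_, fun a k => ?_⟩
  · exact computable_codeCos.comp (Primrec.nat_add.to_comp.comp (Computable.succ.comp .snd)
      (Primrec.nat_mul.to_comp.comp (.const 4) hB)) hg1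
  · have h3 : (1 : ℝ) / 2 ^ k = 1 / 2 ^ (k + 1) + 1 / 2 ^ (k + 1) := by rw [pow_succ]; ring
    rw [val_codeCos, h3]
    refine (abs_sub_le _ (Real.cos (RatCode.val (g a (k + 1)))) _).trans (add_le_add ?_ ?_)
    · exact (Real.abs_cos_sub_cos_le _ _).trans (h a (k + 1))
    · exact abs_cos_sub_cosApprox_le (abs_val_le _) rfl

/-! ### Integrals against complex measures -/

/-- The variation of a complex measure is finite. -/
theorem isFiniteMeasure_variation {X : Type*} [MeasurableSpace X] (μ : ComplexMeasure X) :
    IsFiniteMeasure μ.variation := by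
  have h : μ.variation ≤ (ComplexMeasure.re μ).variation + (ComplexMeasure.im μ).variation := by
    refine VectorMeasure.variation_le_of_forall_enorm_le fun s hs => ?_
    have h1 : ‖μ s‖ₑ ≤ ‖ComplexMeasure.re μ s‖ₑ + ‖ComplexMeasure.im μ s‖ₑ := by
      have hre : ComplexMeasure.re μ s = (μ s).re := rfl
      have him : ComplexMeasure.im μ s = (μ s).im := rfl
      rw [hre, him, ← ofReal_norm, ← ofReal_norm, ← ofReal_norm,
        ← ENNReal.ofReal_add (norm_nonneg _) (norm_nonneg _)]
      exact ENNReal.ofReal_le_ofReal (Complex.norm_le_abs_re_add_abs_im _)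
    exact h1.trans (add_le_add (VectorMeasure.enorm_measure_le_variation _ _)
      (VectorMeasure.enorm_measure_le_variation _ _))
  have : IsFiniteMeasure
      ((ComplexMeasure.re μ).variation + (ComplexMeasure.im μ).variation) := by
    rw [← SignedMeasure.totalVariation_eq_variation, ← SignedMeasure.totalVariation_eq_variation]
    infer_instance
  exact isFiniteMeasure_of_le _ h

section Integral

variable {X : Type*} [MeasurableSpace X] (μ : ComplexMeasure X)

theorem complexIntegral_const_mul (c : ℂ) (f : X → ℂ) :
    complexIntegral μ (fun s => c * f s) = c * complexIntegral μ f := by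
  rw [complexIntegral, complexIntegral, VectorMeasure.integral_eq_setToFun,
    VectorMeasure.integral_eq_setToFun]
  refine setToFun_smul (𝕜 := ℂ) _ (fun c s x => ?_) c f
  exact mul_assoc c x (μ s)

theorem complexIntegral_add {f g : X → ℂ} (hf : μ.Integrable f) (hg : μ.Integrable g) :
    complexIntegral μ (fun s => f s + g s) = complexIntegral μ f + complexIntegral μ g :=
  VectorMeasure.integral_fun_add hf hg

theorem complexIntegral_finsetSum {ι : Type*} (S : Finset ι) {f : ι → X → ℂ}
    (hf : ∀ i ∈ S, μ.Integrable (f i)) :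
    complexIntegral μ (fun s => ∑ i ∈ S, f i s) = ∑ i ∈ S, complexIntegral μ (f i) :=
  VectorMeasure.integral_finsetSum S hf

end Integral

/-! ### The Fejér kernel -/

/-- The weight of the `n`-th cosine in a Dirichlet or Fejér kernel. -/
def cosWeight (n : ℕ) : ℝ := if n = 0 then 1 else 2

/-- The Fejér kernel. -/
noncomputable def fejerKernel (N : ℕ) (u : ℝ) : ℝ :=
  ∑ n ∈ Finset.range (N + 1), (1 - (n : ℝ) / N) * (cosWeight n * Real.cos (2 * Real.pi * n * u))

/-- The Fejér kernel is, up to a factor, the square of the modulus of a geometric sum. -/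
theorem sum_cos_sq_add_sum_sin_sq (N : ℕ) (θ : ℝ) :
    (∑ j ∈ Finset.range N, Real.cos (j * θ)) ^ 2 + (∑ j ∈ Finset.range N, Real.sin (j * θ)) ^ 2 =
      ∑ n ∈ Finset.range (N + 1), ((N : ℝ) - n) * (cosWeight n * Real.cos (n * θ)) := by
  induction N with
  | zero => simp
  | succ N ih =>
    have h1 : ∑ n ∈ Finset.range (N + 1 + 1),
        (((N + 1 : ℕ) : ℝ) - n) * (cosWeight n * Real.cos (n * θ)) =
        ∑ n ∈ Finset.range (N + 1), ((N : ℝ) - n) * (cosWeight n * Real.cos (n * θ)) +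
          ∑ n ∈ Finset.range (N + 1), cosWeight n * Real.cos (n * θ) := by
      rw [Finset.sum_range_succ, sub_self, zero_mul, add_zero, ← Finset.sum_add_distrib]
      refine Finset.sum_congr rfl fun n _ => ?_
      push_cast
      ring
    have h2 : ∑ n ∈ Finset.range (N + 1), cosWeight n * Real.cos (n * θ) =
        1 + 2 * ∑ j ∈ Finset.range N, Real.cos ((N - j) * θ) := by
      rw [Finset.sum_range_succ', ← Finset.sum_range_reflect, Finset.mul_sum, add_comm]
      congr 1
      · simp [cosWeight]
      · refine Finset.sum_congr rfl fun j hj => ?_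
        have hj := Finset.mem_range.1 hj
        have : ((N - 1 - j + 1 : ℕ) : ℝ) = N - j := by
          rw [show N - 1 - j + 1 = N - j by omega, Nat.cast_sub hj.le]
        rw [this, cosWeight, if_neg (by omega)]
    have h3 : ∑ j ∈ Finset.range N, Real.cos ((N - j) * θ) =
        Real.cos (N * θ) * ∑ j ∈ Finset.range N, Real.cos (j * θ) +
          Real.sin (N * θ) * ∑ j ∈ Finset.range N, Real.sin (j * θ) := by
      rw [Finset.mul_sum, Finset.mul_sum, ← Finset.sum_add_distrib]
      refine Finset.sum_congr rfl fun j _ => ?_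
      rw [sub_mul, Real.cos_sub]
    rw [h1, ← ih, h2, h3, Finset.sum_range_succ, Finset.sum_range_succ]
    linear_combination Real.cos_sq_add_sin_sq (N * θ)

theorem fejerKernel_nonneg (N : ℕ) (hN : 1 ≤ N) (u : ℝ) : 0 ≤ fejerKernel N u := by
  have hN' : (0 : ℝ) < N := by exact_mod_cast hN
  have h := sum_cos_sq_add_sum_sin_sq N (2 * Real.pi * u)
  have h2 : fejerKernel N u = (∑ n ∈ Finset.range (N + 1),
      ((N : ℝ) - n) * (cosWeight n * Real.cos (n * (2 * Real.pi * u)))) / N := by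
    rw [fejerKernel, Finset.sum_div]
    refine Finset.sum_congr rfl fun n _ => ?_
    rw [show 2 * Real.pi * n * u = n * (2 * Real.pi * u) by ring]
    field_simp
  rw [h2, ← h]
  positivity

theorem continuous_fejerKernel (N : ℕ) : Continuous (fejerKernel N) := by
  unfold fejerKernel
  fun_prop

theorem integral_cos_two_pi (n : ℕ) (hn : 1 ≤ n) (c : ℝ) :
    ∫ t in (0 : ℝ)..1, Real.cos (2 * Real.pi * n * t + c) = 0 := by
  have hn' : (n : ℝ) ≠ 0 := by positivity
  have hd : 2 * Real.pi * n ≠ 0 := by positivity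
  rw [intervalIntegral.integral_comp_mul_add (fun u => Real.cos u) hd, integral_cos]
  have h1 : 2 * Real.pi * n * 1 + c = c + n * (2 * Real.pi) := by ring
  rw [h1, Real.sin_add_nat_mul_two_pi]
  simp

theorem integral_fejerKernel (N : ℕ) (s : ℝ) :
    ∫ t in (0 : ℝ)..1, fejerKernel N (t - s) = 1 := by
  unfold fejerKernel
  rw [intervalIntegral.integral_finsetSum fun n _ =>
    Continuous.intervalIntegrable (by fun_prop) _ _, Finset.sum_range_succ']
  rw [Finset.sum_eq_zero]
  · simp [cosWeight]
  · intro n _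
    rw [intervalIntegral.integral_const_mul, intervalIntegral.integral_const_mul]
    have : ∀ t, 2 * Real.pi * ((n + 1 : ℕ) : ℝ) * (t - s) =
      2 * Real.pi * ((n + 1 : ℕ) : ℝ) * t + -(2 * Real.pi * ((n + 1 : ℕ) : ℝ) * s) := by
      intro t
      ring
    simp only [this, integral_cos_two_pi _ (Nat.le_add_left 1 n), mul_zero]

/-! ### Fejér sums of Fourier–Stieltjes series -/

/-- The Fejér sums of a Fourier–Stieltjes series are the convolutions of the measure with the Fejér
kernels. -/
theorem fejerSum_eq_complexIntegral {y φ : ℕ → ℝ} {μ : ComplexMeasure (Set.Icc (0 : ℝ) 1)}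
    (h0 : ((y 0 * Real.cos (φ 0) : ℝ) : ℂ) = complexIntegral μ (fun _ => 1))
    (h1 : ∀ n : ℕ, 1 ≤ n →
      (y n : ℂ) * Complex.exp (Complex.I * φ n) =
        2 * complexIntegral μ (fun t => Complex.exp (-(2 * Real.pi * Complex.I * n * (t : ℝ)))) ∧
      (y n : ℂ) * Complex.exp (-(Complex.I * φ n)) =
        2 * complexIntegral μ (fun t => Complex.exp (2 * Real.pi * Complex.I * n * (t : ℝ))))
    (N : ℕ) (t : ℝ) :
    (fejerSum y φ N t : ℂ) = complexIntegral μ fun s => (fejerKernel N (t - s) : ℂ) := by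
  have := isFiniteMeasure_variation μ
  have hint : ∀ f : Set.Icc (0 : ℝ) 1 → ℂ, Continuous f → μ.Integrable f := fun f hf =>
    hf.integrable_of_hasCompactSupport (HasCompactSupport.of_compactSpace f)
  have hterm : ∀ n : ℕ, ((y n * Real.cos (2 * Real.pi * n * t + φ n) : ℝ) : ℂ) =
      complexIntegral μ fun s => (cosWeight n * Real.cos (2 * Real.pi * n * (t - s)) : ℝ) := by
    intro n
    rcases Nat.eq_zero_or_pos n with rfl | hn
    · simpa [cosWeight] using h0
    · obtain ⟨ha, hb⟩ := h1 n hn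
      set E := Complex.exp (2 * Real.pi * n * t * Complex.I) with hE
      set E' := Complex.exp (-(2 * Real.pi * n * t) * Complex.I) with hE'
      have hR : ∀ s : Set.Icc (0 : ℝ) 1,
          ((cosWeight n * Real.cos (2 * Real.pi * n * (t - s)) : ℝ) : ℂ) =
          E * Complex.exp (-(2 * Real.pi * Complex.I * n * (s : ℝ))) +
          E' * Complex.exp (2 * Real.pi * Complex.I * n * (s : ℝ)) := by
        intro s
        rw [cosWeight, if_neg (by omega)]
        push_cast
        rw [Complex.two_cos, hE, hE', ← Complex.exp_add, ← Complex.exp_add]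
        congr 2 <;> ring
      have hL : ((y n * Real.cos (2 * Real.pi * n * t + φ n) : ℝ) : ℂ) =
          (E * (y n * Complex.exp (Complex.I * φ n)) +
            E' * (y n * Complex.exp (-(Complex.I * φ n)))) / 2 := by
        push_cast
        rw [Complex.cos, mul_left_comm E, mul_left_comm E', hE, hE', ← Complex.exp_add,
          ← Complex.exp_add]
        rw [← mul_add, mul_div_assoc]
        congr 4 <;> ring
      simp only [hR]
      rw [complexIntegral_add, complexIntegral_const_mul, complexIntegral_const_mul, hL, ha, hb]
      · ring
      · exact hint _ (by fun_prop)
      · exact hint _ (by fun_prop)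
  have hK : (fun s : Set.Icc (0 : ℝ) 1 => (fejerKernel N (t - s) : ℂ)) =
      fun s : Set.Icc (0 : ℝ) 1 =>
      ∑ n ∈ Finset.range (N + 1), ((1 - (n : ℝ) / N : ℝ) : ℂ) *
        (cosWeight n * Real.cos (2 * Real.pi * n * (t - s)) : ℝ) := by
    funext s
    rw [fejerKernel]
    push_cast
    rfl
  rw [hK, complexIntegral_finsetSum]
  · simp only [complexIntegral_const_mul, ← hterm]
    rw [fejerSum]
    push_cast
    rfl
  · intro n _
    exact hint _ (by fun_prop)

/-- The Fejér sums of a Fourier–Stieltjes series are bounded in `L¹`. -/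
theorem IsFourierStieltjes.exists_integral_le {y φ : ℕ → ℝ} (h : IsFourierStieltjes y φ) :
    ∃ C : ℝ, ∀ N : ℕ, 1 ≤ N → ∫ t in (0 : ℝ)..1, |fejerSum y φ N t| ≤ C := by
  obtain ⟨μ, h0, h1⟩ := h
  have := isFiniteMeasure_variation μ
  set B := ContinuousLinearMap.mul ℝ ℂ
  refine ⟨‖B‖ * μ.variation.real Set.univ, fun N hN => ?_⟩
  have hcK := continuous_fejerKernel N
  have hpt : ∀ t, |fejerSum y φ N t| ≤
      ‖B‖ * ∫ s : Set.Icc (0 : ℝ) 1, fejerKernel N (t - s) ∂μ.variation := by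
    intro t
    rw [← Real.norm_eq_abs, ← Complex.norm_real, fejerSum_eq_complexIntegral h0 h1]
    refine (VectorMeasure.norm_integral_le_integral_norm).trans (le_of_eq ?_)
    congr 1
    refine integral_congr_ae (Eventually.of_forall fun s => ?_)
    simp [abs_of_nonneg (fejerKernel_nonneg N hN _)]
  have hcont : Continuous fun t => |fejerSum y φ N t| := by
    unfold fejerSum
    fun_prop
  have hprod : Integrable (Function.uncurry fun (t : ℝ) (s : Set.Icc (0 : ℝ) 1) =>
      fejerKernel N (t - s)) ((volume.restrict (Set.Ioc (0 : ℝ) 1)).prod μ.variation) := by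
    obtain ⟨M, hM⟩ : ∃ M, ∀ u, |fejerKernel N u| ≤ M := by
      refine ⟨∑ n ∈ Finset.range (N + 1), |1 - (n : ℝ) / N| * (|cosWeight n| * 1), fun u => ?_⟩
      refine (Finset.abs_sum_le_sum_abs _ _).trans (Finset.sum_le_sum fun n _ => ?_)
      rw [abs_mul, abs_mul]
      gcongr
      exact Real.abs_cos_le_one _
    refine Integrable.of_bound (C := M) ?_ (Eventually.of_forall fun p => hM _)
    refine Continuous.aestronglyMeasurable ?_
    exact hcK.comp (continuous_fst.sub (continuous_subtype_val.comp continuous_snd))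
  calc ∫ t in (0 : ℝ)..1, |fejerSum y φ N t|
      ≤ ∫ t in (0 : ℝ)..1,
          ‖B‖ * ∫ s : Set.Icc (0 : ℝ) 1, fejerKernel N (t - s) ∂μ.variation := by
        refine intervalIntegral.integral_mono_on zero_le_one (hcont.intervalIntegrable _ _) ?_
          fun t _ => hpt t
        rw [intervalIntegrable_iff_integrableOn_Ioc_of_le zero_le_one]
        exact hprod.integral_prod_left.const_mul _
    _ = ‖B‖ * ∫ s : Set.Icc (0 : ℝ) 1, (∫ t in (0 : ℝ)..1, fejerKernel N (t - s)) ∂μ.variation := by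
        rw [intervalIntegral.integral_const_mul]
        simp only [intervalIntegral.integral_of_le (zero_le_one' ℝ)]
        rw [integral_integral_swap hprod]
    _ = ‖B‖ * μ.variation.real Set.univ := by
        simp only [integral_fejerKernel, integral_const, smul_eq_mul, mul_one]

/-! ### Norms of Fejér sums -/

/-- The `L¹` norm of the Fejér sum whose signs are the bits of `l` and whose order is the length of
`l`; the term of that order has the coefficient `0` and is left out. -/
noncomputable def fejerNorm (x φ : ℕ → ℝ) (l : List Bool) : ℝ :=
  ∫ t in (0 : ℝ)..1, |radSum (trigTerm 0 (fun n => (1 - (n : ℝ) / l.length) * x n) φ t) l|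

theorem integral_abs_fejerSum (x φ : ℕ → ℝ) (α : ℕ → Bool) {N : ℕ} (hN : 1 ≤ N) :
    ∫ t in (0 : ℝ)..1, |fejerSum (fun n => rademacher α n * x n) φ N t| =
      fejerNorm x φ (initialSegment α N) := by
  have hN' : (N : ℝ) ≠ 0 := by positivity
  unfold fejerNorm
  congr 1
  funext t
  rw [fejerSum, Finset.sum_range_succ, div_self hN', sub_self, zero_mul, add_zero, radSum,
    length_initialSegment]
  congr 1
  refine Finset.sum_congr rfl fun n hn => ?_
  have hn := Finset.mem_range.1 hn
  have h1 : (initialSegment α N).getD n false = α n := by simp [initialSegment, hn]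
  have h2 : bitSign (α n) = rademacher α n := rfl
  rw [h1, h2, trigTerm, zero_add]
  ring

/-- However the first `m` signs are chosen, at least a fixed proportion of the continuations up to
a suitable level `M` has a large norm. -/
theorem exists_card_fejerNorm_le {x φ : ℕ → ℝ} (hdiv : ¬ Summable fun n => x n ^ 2) {m : ℕ}
    (hm : 1 ≤ m) (D : ℝ) :
    ∃ r, 1 ≤ r ∧ ∀ τ : List Bool, τ.length = m →
      1296 * ((cube r).filter fun ρ => fejerNorm x φ (τ ++ ρ) ≤ D).card ≤ 1295 * 2 ^ r := by
  set P := ∑ n ∈ Finset.range m, |x n| with hP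
  have hP0 : 0 ≤ P := Finset.sum_nonneg fun _ _ => abs_nonneg _
  set W := 36 * (|D| + P) + 1 with hW
  have hW1 : 1 ≤ W := by have := abs_nonneg D; rw [hW]; linarith
  obtain ⟨J, hJ⟩ := (((not_summable_iff_tendsto_nat_atTop_of_nonneg fun n => sq_nonneg (x n)).1
    hdiv).eventually_ge_atTop (4 * (∑ n ∈ Finset.range m, x n ^ 2 + W ^ 2))).exists
  set r := 2 * J + 1 with hr
  have hM0 : (0 : ℝ) < (m + r : ℕ) := by positivity
  set c : ℕ → ℝ := fun n => (1 - (n : ℝ) / (m + r : ℕ)) * x n with hc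
  have hcle : ∀ n, n < m + r → 0 ≤ 1 - (n : ℝ) / (m + r : ℕ) ∧ 1 - (n : ℝ) / (m + r : ℕ) ≤ 1 := by
    intro n hn
    have h1 : (n : ℝ) / (m + r : ℕ) ≤ 1 := (div_le_one hM0).2 (by exact_mod_cast hn.le)
    have h2 : 0 ≤ (n : ℝ) / (m + r : ℕ) := by positivity
    constructor <;> linarith
  have hcx : ∀ n, n < m + r → |c n| ≤ |x n| := by
    intro n hn
    rw [hc, abs_mul, abs_of_nonneg (hcle n hn).1]
    exact mul_le_of_le_one_left (abs_nonneg _) (hcle n hn).2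
  have hsum : W ^ 2 ≤ ∑ i ∈ Finset.range r, c (m + i) ^ 2 := by
    have h1 : ∑ n ∈ Finset.range (m + r), c n ^ 2 =
        ∑ n ∈ Finset.range m, c n ^ 2 + ∑ i ∈ Finset.range r, c (m + i) ^ 2 :=
      Finset.sum_range_add _ _ _
    have h2 : ∑ n ∈ Finset.range m, c n ^ 2 ≤ ∑ n ∈ Finset.range m, x n ^ 2 :=
      Finset.sum_le_sum fun n hn => sq_le_sq.2 (hcx n (by have := Finset.mem_range.1 hn; omega))
    have h3 : ∑ n ∈ Finset.range J, x n ^ 2 / 4 ≤ ∑ n ∈ Finset.range (m + r), c n ^ 2 := by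
      refine le_trans (Finset.sum_le_sum fun n hn => ?_)
        (Finset.sum_le_sum_of_subset_of_nonneg (Finset.range_mono (by omega : J ≤ m + r))
          fun _ _ _ => sq_nonneg _)
      -- below half of the order, the Fejér coefficients are at least `1 / 2`
      have hnJ := Finset.mem_range.1 hn
      have h4 : (n : ℝ) / (m + r : ℕ) ≤ 1 / 2 := by
        rw [div_le_div_iff₀ hM0 (by norm_num)]
        exact_mod_cast (by omega : n * 2 ≤ 1 * (m + r))
      have h5 : (1 / 2 : ℝ) ^ 2 ≤ (1 - (n : ℝ) / (m + r : ℕ)) ^ 2 := by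
        gcongr
        linarith
      rw [hc, mul_pow]
      calc x n ^ 2 / 4 = (1 / 2) ^ 2 * x n ^ 2 := by ring
        _ ≤ _ := by gcongr
    rw [← Finset.sum_div] at h3
    linarith
  set s := √(∑ i ∈ Finset.range r, c (m + i) ^ 2) with hs
  have hs2 : s ^ 2 = ∑ i ∈ Finset.range r, c (m + i) ^ 2 :=
    Real.sq_sqrt (Finset.sum_nonneg fun _ _ => sq_nonneg _)
  have hWs : W ≤ s := Real.le_sqrt_of_sq_le hsum
  refine ⟨r, by omega, fun τ hτ => le_trans ?_
    (card_small_integral_le hm (fun i => c (m + i)) φ r (by linarith) hs2)⟩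
  refine Nat.mul_le_mul_left _ (Finset.card_le_card fun ρ hmem => ?_)
  obtain ⟨hρ, hle⟩ := Finset.mem_filter.1 hmem
  refine Finset.mem_filter.2 ⟨hρ, ?_⟩
  have hlen : (τ ++ ρ).length = m + r := by rw [List.length_append, hτ, mem_cube.1 hρ]
  have hcont := continuous_radSum (continuous_trigTerm m (fun i => c (m + i)) φ) ρ
  have hcont' := continuous_radSum (continuous_trigTerm 0 c φ) (τ ++ ρ)
  have hle' : ∫ t in (0 : ℝ)..1, |radSum (trigTerm 0 c φ t) (τ ++ ρ)| ≤ D := by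
    rw [fejerNorm, hlen] at hle
    exact hle
  have hpt : ∀ t, |radSum (trigTerm m (fun i => c (m + i)) φ t) ρ| ≤
      |radSum (trigTerm 0 c φ t) (τ ++ ρ)| + P := by
    intro t
    have h1 : radSum (trigTerm 0 c φ t) (τ ++ ρ) = radSum (trigTerm 0 c φ t) τ +
        radSum (trigTerm m (fun i => c (m + i)) φ t) ρ := by
      rw [radSum_append, hτ]
      simp only [trigTerm, zero_add]
      rfl
    have h2 : |radSum (trigTerm 0 c φ t) τ| ≤ P := by
      refine (abs_radSum_le _ _).trans ?_
      rw [hτ]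
      refine Finset.sum_le_sum fun n hn => ?_
      rw [trigTerm, abs_mul]
      refine (mul_le_of_le_one_right (abs_nonneg _) (Real.abs_cos_le_one _)).trans (hcx n ?_)
      have := Finset.mem_range.1 hn
      omega
    have h3 := abs_sub (radSum (trigTerm 0 c φ t) (τ ++ ρ)) (radSum (trigTerm 0 c φ t) τ)
    rw [h1, add_sub_cancel_left, ← h1] at h3
    linarith
  calc ∫ t in (0 : ℝ)..1, |radSum (trigTerm m (fun i => c (m + i)) φ t) ρ|
      ≤ ∫ t in (0 : ℝ)..1, (|radSum (trigTerm 0 c φ t) (τ ++ ρ)| + P) :=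
        intervalIntegral.integral_mono_on zero_le_one (hcont.abs.intervalIntegrable _ _)
          ((hcont'.abs.add continuous_const).intervalIntegrable _ _) fun t _ => hpt t
    _ ≤ D + P := by
        rw [intervalIntegral.integral_add (hcont'.abs.intervalIntegrable _ _) (by simp)]
        simpa using hle'
    _ ≤ s / 36 := by
        have := le_abs_self D
        linarith

/-! ### Computing the norms of Fejér sums -/

/-- The error of a Riemann sum of a Lipschitz function. -/
theorem abs_integral_sub_riemannSum_le {f : ℝ → ℝ} (hf : Continuous f) {K T : ℝ} (hT : 0 ≤ T)
    (hK : ∀ u v, |f u - f v| ≤ K * |u - v|) {L : ℕ} (hL : 1 ≤ L) :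
    |(∫ u in (0 : ℝ)..T, f u) - T / L * ∑ j ∈ Finset.range L, f (T / L * j)| ≤ K * T ^ 2 / L := by
  have hL0 : (0 : ℝ) < L := by exact_mod_cast hL
  have hh : 0 ≤ T / L := by positivity
  have hK0 : 0 ≤ K := by simpa using (abs_nonneg _).trans (hK 1 0)
  have h1 : ∫ u in (0 : ℝ)..T, f u =
      ∑ j ∈ Finset.range L, ∫ u in (T / L * j)..(T / L * (j + 1 : ℕ)), f u := by
    have h := intervalIntegral.sum_integral_adjacent_intervals (f := f) (μ := volume)
      (a := fun j : ℕ => T / L * j) (n := L) fun j _ => hf.intervalIntegrable _ _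
    rw [h]
    congr 1
    · simp
    · field_simp
  rw [h1, Finset.mul_sum, ← Finset.sum_sub_distrib]
  have h2 : ∀ j : ℕ, |(∫ u in (T / L * j)..(T / L * (j + 1 : ℕ)), f u) - T / L * f (T / L * j)| ≤
      K * (T / L) * (T / L) := by
    intro j
    have hlen : T / L * (j + 1 : ℕ) - T / L * j = T / L := by push_cast; ring
    have h3 : (∫ u in (T / L * j)..(T / L * (j + 1 : ℕ)), f u) - T / L * f (T / L * j) =
        ∫ u in (T / L * j)..(T / L * (j + 1 : ℕ)), (f u - f (T / L * j)) := by
      rw [intervalIntegral.integral_sub (hf.intervalIntegrable _ _) (by simp),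
        intervalIntegral.integral_const, hlen, smul_eq_mul]
    rw [h3, ← Real.norm_eq_abs]
    refine (intervalIntegral.norm_integral_le_of_norm_le_const (C := K * (T / L))
      fun u hu => ?_).trans (le_of_eq ?_)
    · rw [Set.uIoc_of_le (by linarith), Set.mem_Ioc] at hu
      refine (hK u _).trans ?_
      gcongr
      rw [abs_of_nonneg (by linarith)]
      linarith
    · rw [hlen, abs_of_nonneg hh]
  calc _ ≤ ∑ j ∈ Finset.range L, K * (T / L) * (T / L) :=
        (Finset.abs_sum_le_sum_abs _ _).trans (Finset.sum_le_sum fun j _ => h2 j)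
    _ = K * T ^ 2 / L := by
        rw [Finset.sum_const, Finset.card_range, nsmul_eq_mul]
        field_simp

/-- The term of index `n` of a trigonometric series of period `2 π`. -/
noncomputable def waveTerm (a ψ : ℕ → ℝ) (u : ℝ) (n : ℕ) : ℝ := a n * Real.cos (n * u + ψ n)

theorem continuous_waveTerm (a ψ : ℕ → ℝ) (n : ℕ) : Continuous fun u => waveTerm a ψ u n := by
  unfold waveTerm
  fun_prop

/-- The interval `[0, 8]` covers at least one and at most two periods, so that an integral over it,
whose Riemann sums do not involve `π`, may replace that over a period. -/
theorem integral_waveTerm_bounds (a ψ : ℕ → ℝ) (l : List Bool) :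
    (∫ t in (0 : ℝ)..1, |radSum (trigTerm 0 a ψ t) l|) ≤
        ∫ u in (0 : ℝ)..8, |radSum (waveTerm a ψ u) l| ∧
      (∫ u in (0 : ℝ)..8, |radSum (waveTerm a ψ u) l|) ≤
        16 * ∫ t in (0 : ℝ)..1, |radSum (trigTerm 0 a ψ t) l| := by
  set g : ℝ → ℝ := fun u => |radSum (waveTerm a ψ u) l| with hg
  set F := ∫ t in (0 : ℝ)..1, |radSum (trigTerm 0 a ψ t) l| with hF
  have hF0 : 0 ≤ F := intervalIntegral.integral_nonneg zero_le_one fun _ _ => abs_nonneg _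
  have hgc : Continuous g := (continuous_radSum (continuous_waveTerm a ψ) l).abs
  have hper : Function.Periodic g (2 * Real.pi) := by
    intro u
    simp only [hg, radSum, waveTerm]
    congr 1
    refine Finset.sum_congr rfl fun n _ => ?_
    rw [show (n : ℝ) * (u + 2 * Real.pi) + ψ n = n * u + ψ n + n * (2 * Real.pi) by ring,
      Real.cos_add_nat_mul_two_pi]
  have hgF : ∫ u in (0 : ℝ)..(2 * Real.pi), g u = 2 * Real.pi * F := by
    have h := intervalIntegral.mul_integral_comp_mul_left (f := g) (a := 0) (b := 1) (2 * Real.pi)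
    rw [mul_zero, mul_one] at h
    rw [← h, hF]
    congr 2
    funext t
    simp only [hg, radSum, waveTerm, trigTerm, zero_add]
    congr 1
    refine Finset.sum_congr rfl fun n _ => ?_
    rw [show (n : ℝ) * (2 * Real.pi * t) = 2 * Real.pi * n * t by ring]
  have hgF2 : ∫ u in (0 : ℝ)..(4 * Real.pi), g u = 4 * Real.pi * F := by
    have h := hper.intervalIntegral_add_eq (2 * Real.pi) 0
    rw [zero_add, show 2 * Real.pi + 2 * Real.pi = 4 * Real.pi by ring] at h
    rw [← intervalIntegral.integral_add_adjacent_intervals (b := 2 * Real.pi)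
      (hgc.intervalIntegrable _ _) (hgc.intervalIntegrable _ _), h, hgF]
    ring
  have hpi := Real.pi_gt_three
  have hpi4 := Real.pi_le_four
  have hnn : ∀ u, 0 ≤ g u := fun u => abs_nonneg _
  have hmono : ∀ {b c : ℝ}, 0 ≤ b → b ≤ c → ∫ u in (0 : ℝ)..b, g u ≤ ∫ u in (0 : ℝ)..c, g u :=
    fun hb hbc => intervalIntegral.integral_mono_interval le_rfl hb hbc
      (Eventually.of_forall hnn) (hgc.intervalIntegrable _ _)
  constructor
  · have h := hmono (b := 2 * Real.pi) (c := 8) (by positivity) (by linarith)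
    rw [hgF] at h
    nlinarith
  · have h := hmono (b := 8) (c := 4 * Real.pi) (by norm_num) (by linarith)
    rw [hgF2] at h
    nlinarith

/-- The norm of the Fejér sums is, up to constants, a computable function of the signs. -/
theorem exists_computableFamily_fejerNorm {x φ : ℕ → ℝ} (hx : ComputableFamily x)
    (hφ : ComputableFamily φ) :
    ∃ G : List Bool → ℝ, ComputableFamily G ∧
      ∀ l, fejerNorm x φ l ≤ G l + 1 ∧ G l ≤ 16 * fejerNorm x φ l + 1 := by
  have hlen : Computable fun l : List Bool => l.length := Computable.list_length
  obtain ⟨K, hK, hKle⟩ := (ComputableFamily.sum (A := List Bool)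
    (F := fun _ n => (n : ℝ) * |x n|)
    ((ComputableFamily.natCast Computable.snd).mul (hx.abs.comp Computable.snd)) hlen).exists_bound
  -- the number of nodes that makes the error `K 8² / L` of the Riemann sum at most `1`
  set L : List Bool → ℕ := fun l => 64 * K l + 1 with hL
  have hLc : Computable L :=
    Computable.succ.comp (Primrec.nat_mul.to_comp.comp (Computable.const 64) hK)
  let a : List Bool → ℕ → ℝ := fun l n => (1 - (n : ℝ) / l.length) * x n
  refine ⟨fun l => 8 / L l * ∑ j ∈ Finset.range (L l),
    |radSum (waveTerm (a l) φ (8 / L l * j)) l|, ?_, fun l => ?_⟩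
  · have h8 : ComputableFamily fun l => 8 / (L l : ℝ) := by
      simpa [div_eq_mul_inv] using (ComputableFamily.natCast (A := List Bool)
        (Computable.const 8)).mul (ComputableFamily.inv_natCast hLc)
    refine h8.mul (ComputableFamily.sum
      (F := fun l j => |radSum (waveTerm (a l) φ (8 / L l * j)) l|) (ComputableFamily.abs ?_) hLc)
    -- the variables of the innermost term are the string `l`, the node `j` and the frequency `n`
    have cl : Computable fun p : (List Bool × ℕ) × ℕ => p.1.1 := Computable.fst.comp .fst
    have cj : Computable fun p : (List Bool × ℕ) × ℕ => p.1.2 := Computable.snd.comp .fst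
    have cn : Computable fun p : (List Bool × ℕ) × ℕ => p.2 := Computable.snd
    refine ComputableFamily.sum (A := List Bool × ℕ) (F := fun p n =>
      bitSign (p.1.getD n false) * waveTerm (a p.1) φ (8 / L p.1 * p.2) n) ?_
      (hlen.comp Computable.fst)
    have hsign : ComputableFamily fun p : (List Bool × ℕ) × ℕ =>
        bitSign (p.1.1.getD p.2 false) := by
      have hbit : Computable fun p : (List Bool × ℕ) × ℕ => p.1.1.getD p.2 false :=
        (Primrec.list_getD false).to_comp.comp cl cn
      have := ComputableFamily.val (Computable.cond hbit
        (Computable.const ((1, 0, 0) : RatCode)) (Computable.const ((0, 1, 0) : RatCode)))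
      convert this using 2 with p
      cases p.1.1.getD p.2 false <;> simp [bitSign, RatCode.val]
    have hone : ComputableFamily fun _ : (List Bool × ℕ) × ℕ => (1 : ℝ) := by
      simpa using ComputableFamily.natCast (A := (List Bool × ℕ) × ℕ) (Computable.const 1)
    have hneg : ComputableFamily fun _ : (List Bool × ℕ) × ℕ => (-1 : ℝ) := by
      simpa [RatCode.val] using ComputableFamily.val (A := (List Bool × ℕ) × ℕ)
        (Computable.const ((0, 1, 0) : RatCode))
    have hcoef : ComputableFamily fun p : (List Bool × ℕ) × ℕ =>
        1 - (p.2 : ℝ) / p.1.1.length := by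
      simpa [div_eq_mul_inv, sub_eq_add_neg] using hone.add (hneg.mul
        ((ComputableFamily.natCast cn).mul (ComputableFamily.inv_natCast (hlen.comp cl))))
    exact hsign.mul ((hcoef.mul (hx.comp cn)).mul
      (((ComputableFamily.natCast cn).mul ((h8.comp cl).mul (ComputableFamily.natCast cj))).add
        (hφ.comp cn)).cos)
  · have hKl := (le_abs_self _).trans (hKle l)
    have hlip : ∀ u v, |(|radSum (waveTerm (a l) φ u) l| - |radSum (waveTerm (a l) φ v) l|)| ≤
        K l * |u - v| := by
      intro u v
      refine (abs_abs_sub_abs_le_abs_sub _ _).trans ?_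
      rw [radSum, radSum, ← Finset.sum_sub_distrib]
      refine (Finset.abs_sum_le_sum_abs _ _).trans ?_
      refine le_trans ?_ (mul_le_mul_of_nonneg_right hKl (abs_nonneg _))
      rw [Finset.sum_mul]
      refine Finset.sum_le_sum fun n hn => ?_
      have hn : (n : ℝ) ≤ l.length := by exact_mod_cast (Finset.mem_range.1 hn).le
      have h0 : 0 ≤ (n : ℝ) / l.length := by positivity
      have h1 : (n : ℝ) / l.length ≤ 1 := div_le_one_of_le₀ hn (by positivity)
      have h2 : |a l n| ≤ |x n| := by
        rw [abs_mul, abs_of_nonneg (by linarith)]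
        exact mul_le_of_le_one_left (abs_nonneg _) (by linarith)
      have h3 := Real.abs_cos_sub_cos_le (n * u + φ n) (n * v + φ n)
      rw [add_sub_add_right_eq_sub, ← mul_sub, abs_mul, Nat.abs_cast] at h3
      rw [← mul_sub, abs_mul, abs_bitSign, one_mul, waveTerm, waveTerm, ← mul_sub, abs_mul]
      calc _ ≤ |x n| * (n * |u - v|) := by gcongr
        _ = _ := by ring
    have hR := abs_integral_sub_riemannSum_le
      (continuous_radSum (continuous_waveTerm (a l) φ) l).abs (by norm_num : (0 : ℝ) ≤ 8) hlip
      (L := L l) (Nat.le_add_left 1 _)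
    have herr : (K l : ℝ) * 8 ^ 2 / L l ≤ 1 := by
      rw [div_le_one (by positivity)]
      simp only [hL]
      push_cast
      linarith
    have hR := abs_le.1 (hR.trans herr)
    obtain ⟨hb1, hb2⟩ := integral_waveTerm_bounds (a l) φ l
    have hdef : fejerNorm x φ l = ∫ t in (0 : ℝ)..1, |radSum (trigTerm 0 (a l) φ t) l| := rfl
    rw [hdef]
    constructor <;> linarith [hR.1, hR.2]

/-- A computable test that separates small from large norms of Fejér sums. -/
theorem exists_computable_test {x φ : ℕ → ℝ} (hx : ComputableFamily x) (hφ : ComputableFamily φ)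
    (C : ℕ) : ∃ (test : List Bool → Bool) (D : ℝ), Computable test ∧
      (∀ l, fejerNorm x φ l ≤ C → test l = true) ∧ ∀ l, test l = true → fejerNorm x φ l ≤ D := by
  obtain ⟨G, ⟨g, hg, hgG⟩, hG⟩ := exists_computableFamily_fejerNorm hx hφ
  have hg0 : Computable fun l => g l 0 := hg.comp .id (.const 0)
  have hv : Computable fun l => (g l 0).2 := Computable.snd.comp hg0
  refine ⟨fun l => decide ((g l 0).1 ≤ (g l 0).2.1 + (16 * C + 2) * ((g l 0).2.2 + 1)),
    16 * C + 4, ?_, fun l hl => ?_, fun l hl => ?_⟩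
  · exact Primrec.nat_le.decide.to_comp.comp (Computable.fst.comp hg0)
      (Primrec.nat_add.to_comp.comp (Computable.fst.comp hv)
        (Primrec.nat_mul.to_comp.comp (Computable.const _)
          (Computable.succ.comp (Computable.snd.comp hv))))
  all_goals
    have h1 := abs_le.1 (hgG l 0)
    have h2 := hG l
    norm_num at h1
  · refine decide_eq_true ((RatCode.val_le_iff _ _).1 ?_)
    push_cast
    linarith
  · have h3 := (RatCode.val_le_iff _ _).2 (of_decide_eq_true hl)
    push_cast at h3
    linarith

/-! ### The tree of strings that pass a test -/

/-- The strings of length `n` all of whose nonempty initial segments pass a test. -/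
def testTree (test : List Bool → Bool) (n : ℕ) : List (List Bool) :=
  (strings n).filter fun l => decide (∀ j < n, test (l.take (j + 1)) = true)

theorem mem_testTree {test : List Bool → Bool} {n : ℕ} {l : List Bool} :
    l ∈ testTree test n ↔ l.length = n ∧ ∀ j < n, test (l.take (j + 1)) = true := by
  simp [testTree, mem_strings]

theorem computable_filter {A B : Type*} [Primcodable A] [Primcodable B] {f : A → List B}
    {p : A → B → Bool} (hf : Computable f) (hp : Computable₂ p) :
    Computable fun a => (f a).filter (p a) := by
  let step : A → ℕ × List B → List B := fun a s =>
    Option.casesOn ((f a)[s.1]?) s.2 fun b => bif p a b then s.2 ++ [b] else s.2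
  have hstep : Computable₂ step := by
    have hs : Computable fun x : A × ℕ × List B => x.2.2 := Computable.snd.comp .snd
    refine Computable.option_casesOn (Computable.list_getElem?.comp (hf.comp .fst)
      (Computable.fst.comp .snd)) hs ?_
    exact Computable.cond (hp.comp (Computable.fst.comp .fst) .snd)
      (Computable.list_concat.comp (hs.comp .fst) .snd) (hs.comp .fst)
  refine (Computable.nat_rec (Computable.list_length.comp hf) (Computable.const []) hstep).of_eq
    fun a => ?_
  have key : ∀ m, (Nat.rec [] (fun i s => step a (i, s)) m : List B) =
      ((f a).take m).filter (p a) := by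
    intro m
    induction m with
    | zero => simp
    | succ m ih =>
      have h1 : (Nat.rec [] (fun i s => step a (i, s)) (m + 1) : List B) =
        step a (m, Nat.rec [] (fun i s => step a (i, s)) m) := rfl
      rw [h1, ih, List.take_add_one, List.filter_append]
      simp only [step]
      cases (f a)[m]? with
      | none => simp
      | some b => cases hpb : p a b <;> simp [hpb]
  exact (key _).trans (by rw [List.take_length])

theorem computable_testTree {test : List Bool → Bool} (ht : Computable test) :
    Computable (testTree test) := by
  refine computable_filter primrec_strings.to_comp ?_
  have hstep : Computable₂ fun (x : ℕ × List Bool) (s : ℕ × Bool) =>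
      s.2 && test (x.2.take (s.1 + 1)) :=
    Primrec.and.to_comp.comp (Computable.snd.comp .snd) (ht.comp
      (Primrec.list_take.to_comp.comp (Computable.succ.comp (Computable.fst.comp .snd))
        (Computable.snd.comp .fst)))
  refine (Computable.nat_rec Computable.fst (Computable.const true) hstep).of_eq fun x => ?_
  have key : ∀ m, (Nat.rec true (fun j s => s && test (x.2.take (j + 1))) m : Bool) =
      decide (∀ j < m, test (x.2.take (j + 1)) = true) := by
    intro m
    induction m with
    | zero => simp
    | succ m ih =>
      have h1 : (Nat.rec true (fun j s => s && test (x.2.take (j + 1))) (m + 1) : Bool) =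
        ((Nat.rec true (fun j s => s && test (x.2.take (j + 1))) m : Bool) &&
          test (x.2.take (m + 1))) := rfl
      rw [h1, ih, Bool.eq_iff_iff]
      simp only [Bool.and_eq_true, decide_eq_true_eq, Nat.lt_succ_iff_lt_or_eq, or_imp,
        forall_and, forall_eq]
  exact key x.1

theorem length_testTree (test : List Bool → Bool) (n : ℕ) :
    (testTree test n).length = (testTree test n).toFinset.card :=
  (List.toFinset_card_of_nodup ((nodup_strings n).filter _)).symm

/-- If every string of length `m` has few extensions of length `m + r` that pass the test, then the
density of the tree drops by a fixed factor between these levels. -/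
theorem length_testTree_add_le {test : List Bool → Bool} {m r p q : ℕ} (hr : 1 ≤ r)
    (h : ∀ τ : List Bool, τ.length = m →
      p * ((cube r).filter fun ρ => test (τ ++ ρ) = true).card ≤ q * 2 ^ r) :
    p * (testTree test (m + r)).length ≤ q * 2 ^ r * (testTree test m).length := by
  classical
  have hsub : (testTree test (m + r)).toFinset ⊆ (testTree test m).toFinset.biUnion fun τ =>
      ((cube r).filter fun ρ => test (τ ++ ρ) = true).image fun ρ => τ ++ ρ := by
    intro l hl
    obtain ⟨hlen, hl⟩ := mem_testTree.1 (List.mem_toFinset.1 hl)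
    refine Finset.mem_biUnion.2 ⟨l.take m, List.mem_toFinset.2 (mem_testTree.2
      ⟨by simp [hlen], fun j hj => ?_⟩), Finset.mem_image.2 ⟨l.drop m, Finset.mem_filter.2
      ⟨mem_cube.2 (by simp [hlen]), ?_⟩, List.take_append_drop m l⟩⟩
    · rw [List.take_take, min_eq_left (by omega)]
      exact hl j (by omega)
    · have := hl (m + r - 1) (by omega)
      rwa [show m + r - 1 + 1 = l.length by omega, List.take_length,
        ← List.take_append_drop m l] at this
  rw [length_testTree, length_testTree]
  calc p * (testTree test (m + r)).toFinset.card
      ≤ p * ∑ τ ∈ (testTree test m).toFinset,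
          ((cube r).filter fun ρ => test (τ ++ ρ) = true).card := by
        gcongr
        refine (Finset.card_le_card hsub).trans (Finset.card_biUnion_le.trans ?_)
        exact Finset.sum_le_sum fun τ _ => Finset.card_image_le
    _ = ∑ τ ∈ (testTree test m).toFinset,
          p * ((cube r).filter fun ρ => test (τ ++ ρ) = true).card := Finset.mul_sum _ _ _
    _ ≤ ∑ τ ∈ (testTree test m).toFinset, q * 2 ^ r := Finset.sum_le_sum fun τ hτ =>
        h τ (mem_testTree.1 (List.mem_toFinset.1 hτ)).1
    _ = _ := by rw [Finset.sum_const, smul_eq_mul, mul_comm]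

/-- A tree whose density drops by a fixed factor infinitely often has density zero. -/
theorem exists_testTree_small {test : List Bool → Bool} {p q : ℕ} (hpq : q < p)
    (h : ∀ m, 1 ≤ m → ∃ r, 1 ≤ r ∧ ∀ τ : List Bool, τ.length = m →
      p * ((cube r).filter fun ρ => test (τ ++ ρ) = true).card ≤ q * 2 ^ r) (k : ℕ) :
    ∃ n, 2 * k ≤ n ∧ (testTree test n).length * 2 ^ (2 * k) ≤ 2 ^ n := by
  have hstep : ∀ j, ∃ n, j + 1 ≤ n ∧ p ^ j * (testTree test n).length ≤ q ^ j * 2 ^ n := by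
    intro j
    induction j with
    | zero =>
      refine ⟨1, le_rfl, ?_⟩
      have : (testTree test 1).length ≤ (strings 1).length := List.length_filter_le _ _
      simpa [length_strings] using this
    | succ j ih =>
      obtain ⟨n, hn, hle⟩ := ih
      obtain ⟨r, hr, hr'⟩ := h n (by omega)
      refine ⟨n + r, by omega, ?_⟩
      calc p ^ (j + 1) * (testTree test (n + r)).length
          = p ^ j * (p * (testTree test (n + r)).length) := by ring
        _ ≤ p ^ j * (q * 2 ^ r * (testTree test n).length) := by
          exact Nat.mul_le_mul_left _ (length_testTree_add_le hr hr')
        _ = q * 2 ^ r * (p ^ j * (testTree test n).length) := by ring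
        _ ≤ q * 2 ^ r * (q ^ j * 2 ^ n) := by gcongr
        _ = _ := by ring
  have hp : (0 : ℝ) < p := by exact_mod_cast (by omega : 0 < p)
  have hlim := tendsto_pow_atTop_nhds_zero_of_lt_one (r := (q : ℝ) / p) (by positivity)
    ((div_lt_one hp).2 (by exact_mod_cast hpq))
  obtain ⟨j, hj, hjk⟩ := ((hlim.eventually_lt_const
    (by positivity : (0 : ℝ) < 1 / 2 ^ (2 * k))).and (eventually_ge_atTop (2 * k))).exists
  obtain ⟨n, hn, hle⟩ := hstep j
  refine ⟨n, by omega, ?_⟩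
  have hj' : q ^ j * 2 ^ (2 * k) ≤ p ^ j := by
    rw [div_pow, div_lt_div_iff₀ (by positivity) (by positivity), one_mul] at hj
    exact_mod_cast hj.le
  have hpj : 0 < p ^ j := pow_pos (by omega) j
  refine Nat.le_of_mul_le_mul_left ?_ hpj
  calc p ^ j * ((testTree test n).length * 2 ^ (2 * k))
      = p ^ j * (testTree test n).length * 2 ^ (2 * k) := by ring
    _ ≤ q ^ j * 2 ^ n * 2 ^ (2 * k) := by gcongr
    _ = q ^ j * 2 ^ (2 * k) * 2 ^ n := by ring
    _ ≤ p ^ j * 2 ^ n := by gcongr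

/-! ### Unboundedness of the Fejér sums -/

theorem take_initialSegment (α : ℕ → Bool) {m n : ℕ} (h : m ≤ n) :
    (initialSegment α n).take m = initialSegment α m := by
  rw [initialSegment, initialSegment, ← List.map_take, List.take_range, min_eq_left h]

/-- For complex signs, the Fejér sums are unbounded in `L¹`. -/
theorem exists_lt_integral_abs_fejerSum {x φ : ℕ → ℝ} (hx : IsComputableSeq x)
    (hφ : IsComputableSeq φ) (hdiv : ¬ Summable fun n => x n ^ 2) {α : ℕ → Bool} (hα : α ∈ KC)
    (C : ℝ) : ∃ N, 1 ≤ N ∧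
      C < ∫ t in (0 : ℝ)..1, |fejerSum (fun n => rademacher α n * x n) φ N t| := by
  by_contra! hcon
  obtain ⟨c, hc⟩ := exists_nat_ge C
  obtain ⟨test, D, ht, h1, h2⟩ :=
    exists_computable_test (φ := φ) hx.computableFamily hφ.computableFamily c
  refine notMem_KC_of_tree (computable_testTree ht)
    (exists_testTree_small (p := 1296) (q := 1295) (by norm_num) fun m hm => ?_) (α := α)
    (fun n => mem_testTree.2 ⟨length_initialSegment α n, fun j hj => ?_⟩) hα
  · obtain ⟨r, hr, h⟩ := exists_card_fejerNorm_le (φ := φ) hdiv hm D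
    refine ⟨r, hr, fun τ hτ => le_trans ?_ (h τ hτ)⟩
    gcongr with ρ
    exact h2 _
  · rw [take_initialSegment α hj]
    apply h1
    rw [← integral_abs_fejerSum x φ α (Nat.le_add_left 1 j)]
    exact (hcon _ (Nat.le_add_left 1 j)).trans hc

/-- A real sequence that is unbounded above on the positive indices has upper limit `∞`. -/
theorem limsup_coe_eq_top {u : ℕ → ℝ} (hu : ∀ C : ℝ, ∃ N, 1 ≤ N ∧ C < u N) :
    limsup (fun N => (u N : EReal)) atTop = ⊤ := by
  by_contra h
  obtain ⟨c, hc, -⟩ := EReal.lt_iff_exists_real_btwn.1 (lt_top_iff_ne_top.2 h)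
  obtain ⟨N₀, hN₀⟩ := eventually_atTop.1 (eventually_lt_of_limsup_lt hc)
  obtain ⟨N, -, hN⟩ := hu (max c (∑ n ∈ Finset.range N₀, |u n|))
  rw [max_lt_iff] at hN
  rcases lt_or_ge N N₀ with hlt | hge
  · have := Finset.single_le_sum (f := fun n => |u n|) (fun n _ => abs_nonneg _)
      (Finset.mem_range.2 hlt)
    exact absurd hN.2 (not_lt.2 ((le_abs_self _).trans this))
  · exact absurd hN.1 (not_lt.2 (EReal.coe_lt_coe_iff.1 (hN₀ N hge)).le)

end AlgRandom

theorem mainTheorem6 (x φ : ℕ → ℝ)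
    (hx : AlgRandom.IsComputableSeq x) (hφ : AlgRandom.IsComputableSeq φ)
    (hdiv : ¬ Summable fun n => x n ^ 2)
    (α : ℕ → Bool) (hα : α ∈ AlgRandom.KC) :
    limsup (fun N : ℕ =>
        ((∫ t in (0 : ℝ)..1,
          |AlgRandom.fejerSum (fun n => AlgRandom.rademacher α n * x n) φ N t| : ℝ) : EReal))
      atTop = ⊤ ∧
    ¬ AlgRandom.IsFourierStieltjes (fun n => AlgRandom.rademacher α n * x n) φ := by
  have h := AlgRandom.exists_lt_integral_abs_fejerSum hx hφ hdiv hα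
  refine ⟨AlgRandom.limsup_coe_eq_top h, fun hFS => ?_⟩
  obtain ⟨C, hC⟩ := hFS.exists_integral_le
  obtain ⟨N, hN, hlt⟩ := h C
  exact (hC N hN).not_gt hlt
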